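/- Let $X$ be a complex Banach space and let $f:[0,\infty)\to X$ be bounded, (continuous and) Lipschitz continuous, with $$\sup_{t\ge0}\Big\|\int_0^t f(s)\,\mathrm ds\Big\|<\infty .$$ Let $\widehat f(\lambda)=\int_0^\infty e^{-\lambda t}f(t)\,\mathrm dt$ $(\operatorname{Re}\lambda>0)$, and suppose that $\widehat f$ admits a boundary function $F\in L^1_{\mathrm{loc}}(\mathbb R\setminus\{0\};X)$, that is, $$\lim_{\alpha\to0+}\int_{\mathbb R}\widehat f(\alpha+is)\psi(s)\,\mathrm ds=\int_{\mathbb R}F(s)\psi(s)\,\mathrm ds\qquad\text{for all }\psi\in C_c(\mathbb R\setminus\{0\}).$$ Then $\|f(t)\|\to0$ as $t\to\infty$. Moreover, let $m:(0,1]\to[1,\infty)$ be continuous and non-increasing, let $M:[1,\infty)\to[1,\infty)$ be continuous and non-decreasing, and for an integer $k\ge1$ put $$m_k(r)=m(r)\Big(\frac{m(r)}{r}\Big)^{1/k},\qquad m_{\log}(r)=m(r)\log\Big(1+\frac{m(r)}{r}\Big)\qquad(0<r\le1),$$ $$M_k(R)=M(R)\big((1+R)^2M(R)\big)^{1/k},\qquad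 M_{\log}(R)=M(R)\big(\log(1+R)+\log M(R)\big)\qquad(R\ge1).$$ These functions are strictly monotone; $m_k^{-1},m_{\log}^{-1},M_k^{-1},M_{\log}^{-1}$ denote their inverse functions, which are defined at all sufficiently large arguments. (a) Suppose that $F\in C^k(\mathbb R\setminus\{0\};X)$ for some $k\ge1$ and that, for some constant $C>0$ and all $0\le j\le k$, $$\|F^{(j)}(s)\|\le C|s|^{k-j}m(|s|)^{k+1}\ \ (0<|s|\le1),\qquad \|F^{(j)}(s)\|\le C\,M(|s|)^{j+1}\ \ (|s|\ge1).$$ Then, for every $c>0$, $$\|f(t)\|=O\Big(m_k^{-1}(ct)+\frac1{M_k^{-1}(ct)}\Big),\qquad t\to\infty.$$ (b) Suppose that $F\in C^\infty(\mathbb R\setminus\{0\};X)$ and that, for some constant $C>0$ and all $j\ge0$, $$\|F^{(j)}(s)\|\le C\,j!\,|s|\,m(|s|)^{j+1}\ \ (0<|s|\le1),\qquad \|F^{(j)}(s)\|\le C\,j!\,M(|s|)^{j+1}\ \ (|s|\ge1).$$ Then, for every $c\in(0,1/2)$, $$\|f(t)\|=O\Big(m_{\log}^{-1}(ct)+\frac1{M_{\log}^{-1}(ct)}+\frac1t\Big),\qquad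 t\to\infty.$$ -/

import Mathlib

open Set Filter Topology MeasureTheory Asymptotics
open scoped ContDiff NNReal

namespace QIngham

noncomputable section

/-- The Laplace transform `∫₀^∞ e^{-λt} f(t) dt` of (the restriction to `[0, ∞)` of) `f`. -/
def laplace {X : Type*} [NormedAddCommGroup X] [NormedSpace ℂ X] (f : ℝ → X) (z : ℂ) : X :=
  ∫ t in Ioi (0 : ℝ), Complex.exp (-z * (t : ℂ)) • f t

/-- `F ∈ L¹_loc(ℝ ∖ S; X)` is a boundary function of the Laplace transform of `f`, for a closed
set `S` of singularities: the functions `s ↦ f̂(α + is)` converge to `F` as `α → 0+` when tested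
against any continuous function with compact support in `ℝ ∖ S`. -/
def IsBoundaryFunction {X : Type*} [NormedAddCommGroup X] [NormedSpace ℂ X]
    (f : ℝ → X) (S : Set ℝ) (F : ℝ → X) : Prop :=
  LocallyIntegrableOn F Sᶜ volume ∧
  ∀ ψ : ℝ → ℂ, Continuous ψ → HasCompactSupport ψ → tsupport ψ ⊆ Sᶜ →
    Tendsto (fun α : ℝ => ∫ s : ℝ, ψ s • laplace f ((α : ℂ) + Complex.I * (s : ℂ)))
      (𝓝[>] 0) (𝓝 (∫ s : ℝ, ψ s • F s))

/-- `m_k(r) = m(r) (m(r) / r)^{1/k}`, for `0 < r ≤ 1`. -/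
def lowerK (m : ℝ → ℝ) (k : ℕ) (r : ℝ) : ℝ := m r * (m r / r) ^ (1 / (k : ℝ))

/-- `m_log(r) = m(r) log (1 + m(r) / r)`, for `0 < r ≤ 1`. -/
def lowerLog (m : ℝ → ℝ) (r : ℝ) : ℝ := m r * Real.log (1 + m r / r)

/-- `M_k(R) = M(R) ((1 + R)² M(R))^{1/k}`, for `R ≥ 1`. -/
def upperK (M : ℝ → ℝ) (k : ℕ) (R : ℝ) : ℝ := M R * ((1 + R) ^ 2 * M R) ^ (1 / (k : ℝ))

/-- `M_log(R) = M(R) (log (1 + R) + log M(R))`, for `R ≥ 1`. -/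
def upperLog (M : ℝ → ℝ) (R : ℝ) : ℝ := M R * (Real.log (1 + R) + Real.log (M R))

/-- The inverse of a function `g` on `(0, 1]` that is injective there (arbitrary off the range). -/
def lowerInv (g : ℝ → ℝ) : ℝ → ℝ := Function.invFunOn g (Ioc 0 1)

/-- The inverse of a function `g` on `[1, ∞)` that is injective there (arbitrary off the range). -/
def upperInv (g : ℝ → ℝ) : ℝ → ℝ := Function.invFunOn g (Ici 1)

/-- `m_k` is strictly decreasing on `(0, 1]`, so that its inverse is defined on its range. -/
theorem lowerK_strictAntiOn {m : ℝ → ℝ} (hm : AntitoneOn m (Ioc 0 1))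
    (hm1 : ∀ r ∈ Ioc (0 : ℝ) 1, 1 ≤ m r) {k : ℕ} (hk : 1 ≤ k) :
    StrictAntiOn (lowerK m k) (Ioc 0 1) := by
  intro a ha b hb hab
  have h1 := hm1 a ha
  have h2 := hm1 b hb
  have h3 := hm ha hb hab.le
  have hk' : (0 : ℝ) < 1 / (k : ℝ) := by positivity
  have ha0 := ha.1
  have hb0 := hb.1
  have h4 : m b / b < m a / a :=
    div_lt_div₀' h3 hab (by linarith) ha0
  have h5 : (m b / b) ^ (1 / (k : ℝ)) < (m a / a) ^ (1 / (k : ℝ)) :=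
    Real.rpow_lt_rpow (by positivity) h4 hk'
  exact mul_lt_mul' h3 h5 (by positivity) (by linarith)

/-- `m_log` is strictly decreasing on `(0, 1]`, so that its inverse is defined on its range. -/
theorem lowerLog_strictAntiOn {m : ℝ → ℝ} (hm : AntitoneOn m (Ioc 0 1))
    (hm1 : ∀ r ∈ Ioc (0 : ℝ) 1, 1 ≤ m r) :
    StrictAntiOn (lowerLog m) (Ioc 0 1) := by
  intro a ha b hb hab
  have h1 := hm1 a ha
  have h2 := hm1 b hb
  have h3 := hm ha hb hab.le
  have ha0 := ha.1
  have hb0 := hb.1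
  have h4 : m b / b < m a / a :=
    div_lt_div₀' h3 hab (by linarith) ha0
  have h6 : 0 < m b / b := by positivity
  have h5 : Real.log (1 + m b / b) < Real.log (1 + m a / a) :=
    Real.log_lt_log (by linarith) (by linarith)
  exact mul_lt_mul' h3 h5 (Real.log_nonneg (by linarith)) (by linarith)

/-- `M_k` is strictly increasing on `[1, ∞)`, so that its inverse is defined on its range. -/
theorem upperK_strictMonoOn {M : ℝ → ℝ} (hM : MonotoneOn M (Ici 1))
    (hM1 : ∀ R ∈ Ici (1 : ℝ), 1 ≤ M R) {k : ℕ} (hk : 1 ≤ k) :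
    StrictMonoOn (upperK M k) (Ici 1) := by
  intro a ha b hb hab
  have h1 := hM1 a ha
  have h2 := hM1 b hb
  have h3 := hM ha hb hab.le
  have hk' : (0 : ℝ) < 1 / (k : ℝ) := by positivity
  have ha1 : (1 : ℝ) ≤ a := ha
  have h4 : (1 + a) ^ 2 * M a < (1 + b) ^ 2 * M b := by
    have : (1 + a) ^ 2 < (1 + b) ^ 2 := by gcongr
    exact mul_lt_mul this h3 (by linarith) (by positivity)
  have h5 : ((1 + a) ^ 2 * M a) ^ (1 / (k : ℝ)) < ((1 + b) ^ 2 * M b) ^ (1 / (k : ℝ)) :=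
    Real.rpow_lt_rpow (by positivity) h4 hk'
  exact mul_lt_mul' h3 h5 (by positivity) (by linarith)

/-- `M_log` is strictly increasing on `[1, ∞)`, so that its inverse is defined on its range. -/
theorem upperLog_strictMonoOn {M : ℝ → ℝ} (hM : MonotoneOn M (Ici 1))
    (hM1 : ∀ R ∈ Ici (1 : ℝ), 1 ≤ M R) :
    StrictMonoOn (upperLog M) (Ici 1) := by
  intro a ha b hb hab
  have h1 := hM1 a ha
  have h2 := hM1 b hb
  have h3 := hM ha hb hab.le
  have ha1 : (1 : ℝ) ≤ a := ha
  have h4 : Real.log (1 + a) < Real.log (1 + b) := Real.log_lt_log (by linarith) (by linarith)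
  have h5 : Real.log (M a) ≤ Real.log (M b) := Real.log_le_log (by linarith) h3
  have h6 : 0 ≤ Real.log (1 + a) := Real.log_nonneg (by linarith)
  have h7 : 0 ≤ Real.log (M a) := Real.log_nonneg h1
  exact mul_lt_mul' h3 (by linarith) (by linarith) (by linarith)

end

end QIngham

/-! Fix a smooth cutoff equal to 1 on [-1, 1] and 0 off [-2, 2], let φ be its inverse Fourier
transform, and smooth `f` at a high scale R and at a low scale r. Then `f(t)` is the sum of three
pieces. The error of the high-scale mollification is O(1/R), because `f` is Lipschitz and φ is
Schwartz with integral 1. The low-scale mollification is O(r), because one integration by parts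
moves the derivative onto the kernel and leaves the bounded primitive of `f`. The difference of the
two mollifications is, up to 1/(2π), the integral of e^{ist} χ(s) F(s), where χ is a band cutoff
vanishing near 0 and for |s| ≥ R, so that the boundary function may be tested against it. This is
`norm_le_add_norm_integral_bandCutoff`, on which everything rests. For fixed r and R the integral
tends to 0 by the Riemann–Lebesgue lemma, which proves `f(t) → 0`.

For (a), integrate by parts k times. Since the i-th derivative of χ is O(|s|^{-i}), the weights
|s|^{k-j} in the hypothesis cancel the loss near 0, and the integral is O((m(r)^{k+1} + R
M(R)^{k+1}) / t^k). Solving m_k(r) = ct = M_k(R) turns this into O(r + 1/R).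

For (b), the number k of integrations by parts grows with t, and no compactly supported χ ≠ 0
satisfies derivative bounds of the form C j! N^j. So only e^{ist} F is integrated repeatedly
(`ibpSum`), and χ is differentiated at most twice. With N = m(r) or N = M(R) and T = t/N, the choice
k = ⌊T⌋ makes the remainder k! N^{k+1} / t^k of size N T e^{-T}. At low frequencies the factor |s|
compensates χ' ~ 1/r. At high frequencies χ' ~ 1/R on a set of length R yields only O(1), and a
second round of integration by parts (`ibpSumTwo`) replaces it by χ'' and yields O(1/R). The line is
cut at ±1, where the two choices of k meet; the boundary terms there produce the 1/t. Solving
m_log(r) = ct = M_log(R) makes the remainders O(r) and O(1/R), the latter because 2c < 1. -/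

namespace QIngham

noncomputable section

open scoped SchwartzMap FourierTransform

variable {X : Type*} [NormedAddCommGroup X] [NormedSpace ℂ X]

/-! ### Mollification at high and low scales -/

/-- The convolution of `f`, restricted to `(0, ∞)`, with the dilated kernel `u ↦ μ φ(μ u)`. -/
def mollify (φ : ℝ → ℂ) (μ : ℝ) (f : ℝ → X) (t : ℝ) : X :=
  ∫ τ in Ioi (0 : ℝ), ((μ : ℂ) * φ (μ * (t - τ))) • f τ

theorem integral_dilate {E : Type*} [NormedAddCommGroup E] [NormedSpace ℝ E] (g : ℝ → E)
    {μ : ℝ} (hμ : 0 < μ) (t : ℝ) :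
    ∫ τ, g (μ * (t - τ)) = μ⁻¹ • ∫ u, g u := by
  rw [integral_sub_left_eq_self (fun τ => g (μ * τ)) volume t, Measure.integral_comp_mul_left,
    abs_of_pos (inv_pos.2 hμ)]

theorem integrable_dilate {E : Type*} [NormedAddCommGroup E] {g : ℝ → E}
    (hg : Integrable g) {μ : ℝ} (hμ : 0 < μ) (t : ℝ) :
    Integrable fun τ => g (μ * (t - τ)) :=
  ((integrable_comp_mul_left_iff g hμ.ne').2 hg).comp_sub_left t

theorem integrable_kernel (φ : 𝓢(ℝ, ℂ)) {μ : ℝ} (hμ : 0 < μ) (t : ℝ) :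
    Integrable fun τ : ℝ => (μ : ℂ) * φ (μ * (t - τ)) :=
  (integrable_dilate φ.integrable hμ t).const_mul _

theorem integrable_kernel_smul (φ : 𝓢(ℝ, ℂ)) {μ : ℝ} (hμ : 0 < μ) (t : ℝ) {f : ℝ → X}
    (hf : Continuous f) {K : ℝ} (hK : ∀ t, ‖f t‖ ≤ K) :
    Integrable fun τ : ℝ => ((μ : ℂ) * φ (μ * (t - τ))) • f τ :=
  (integrable_kernel φ hμ t).smul_bdd K hf.aestronglyMeasurable (ae_of_all _ hK)

/-- A bounded Lipschitz function is approximated by its mollifications at rate `1 / μ`. -/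
theorem norm_sub_mollify_le [CompleteSpace X] (φ : 𝓢(ℝ, ℂ)) (hφ : ∫ u, φ u = 1) {f : ℝ → X}
    (hf : Continuous f) {K : ℝ} (hK : ∀ t, ‖f t‖ ≤ K) {L : ℝ≥0} (hL : LipschitzWith L f) :
    ∃ A : ℝ, ∀ μ > 0, ∀ t ≥ 1, ‖f t - mollify φ μ f t‖ ≤ A / μ := by
  refine ⟨(L + K) * ∫ u, ‖u‖ ^ 1 * ‖φ u‖, fun μ hμ t ht => ?_⟩
  have hK0 : 0 ≤ K := (norm_nonneg _).trans (hK 0)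
  have h1 : f t = ∫ τ, ((μ : ℂ) * φ (μ * (t - τ))) • f t := by
    rw [integral_smul_const, integral_const_mul, integral_dilate (fun u => φ u) hμ, hφ,
      Complex.real_smul]
    have : (μ : ℂ) ≠ 0 := by exact_mod_cast hμ.ne'
    simp [this]
  have h2 : mollify φ μ f t =
      ∫ τ, ((μ : ℂ) * φ (μ * (t - τ))) • (Ioi (0 : ℝ)).indicator f τ := by
    rw [mollify, ← integral_indicator measurableSet_Ioi]
    congr 1 with τ
    by_cases h : τ ∈ Ioi (0 : ℝ) <;> simp [h]
  have hi2 : Integrable fun τ => ((μ : ℂ) * φ (μ * (t - τ))) • (Ioi (0 : ℝ)).indicator f τ := by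
    refine (integrable_kernel φ hμ t).smul_bdd K
      (hf.aestronglyMeasurable.indicator measurableSet_Ioi) (ae_of_all _ fun τ => ?_)
    exact (norm_indicator_le_norm_self _ _).trans (hK τ)
  have hint := φ.integrable_pow_mul volume 1
  rw [h2]
  nth_rewrite 1 [h1]
  rw [← integral_sub ((integrable_kernel φ hμ t).smul_const _) hi2]
  have hb : ∀ τ : ℝ, ‖((μ : ℂ) * φ (μ * (t - τ))) • f t -
      ((μ : ℂ) * φ (μ * (t - τ))) • (Ioi (0 : ℝ)).indicator f τ‖ ≤
      (L + K) * (‖μ * (t - τ)‖ ^ 1 * ‖φ (μ * (t - τ))‖) := by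
    intro τ
    rw [← smul_sub, norm_smul, norm_mul, Complex.norm_real, Real.norm_of_nonneg hμ.le]
    -- The cut at 0 destroys the Lipschitz bound for τ ≤ 0, but there t ≥ 1 gives |t - τ| ≥ 1, so
    -- the sup bound K is at most K |t - τ|.
    have h3 : ‖f t - (Ioi (0 : ℝ)).indicator f τ‖ ≤ (L + K) * |t - τ| := by
      by_cases h : τ ∈ Ioi (0 : ℝ)
      · rw [indicator_of_mem h]
        have := hL.norm_sub_le t τ
        rw [Real.norm_eq_abs] at this
        nlinarith [abs_nonneg (t - τ)]
      · rw [indicator_of_notMem h, sub_zero]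
        have h4 : (1 : ℝ) ≤ |t - τ| := by
          have : τ ≤ 0 := not_lt.1 h
          rw [abs_of_nonneg] <;> linarith
        have := hK t
        have hL0 : (0 : ℝ) ≤ L := L.2
        nlinarith
    calc μ * ‖φ (μ * (t - τ))‖ * ‖f t - (Ioi (0 : ℝ)).indicator f τ‖
        ≤ μ * ‖φ (μ * (t - τ))‖ * ((L + K) * |t - τ|) := by gcongr
      _ = _ := by
        rw [pow_one, norm_mul, Real.norm_of_nonneg hμ.le, Real.norm_eq_abs]; ring
  refine (norm_integral_le_of_norm_le ((integrable_dilate hint hμ t).const_mul _)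
    (ae_of_all _ hb)).trans_eq ?_
  rw [integral_const_mul, integral_dilate (fun u => ‖u‖ ^ 1 * ‖φ u‖) hμ, smul_eq_mul]
  field_simp

/-- Mollifications at scale `μ` of a function with bounded primitive have size `O(μ)`. -/
theorem norm_mollify_le [CompleteSpace X] (φ : 𝓢(ℝ, ℂ)) {f : ℝ → X}
    (hf : Continuous f) {K : ℝ} (hK : ∀ t, ‖f t‖ ≤ K) {K' : ℝ}
    (hK' : ∀ t : ℝ, 0 ≤ t → ‖∫ s in (0 : ℝ)..t, f s‖ ≤ K') :
    ∃ A : ℝ, ∀ μ > 0, ∀ t, ‖mollify φ μ f t‖ ≤ A * μ := by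
  set φ' : 𝓢(ℝ, ℂ) := SchwartzMap.derivCLM ℂ ℂ φ with hφ'
  refine ⟨K' * ∫ u, ‖φ' u‖, fun μ hμ t => ?_⟩
  set g : ℝ → X := fun τ => ∫ s in (0 : ℝ)..τ, f s with hg
  have hgd : ∀ τ, HasDerivAt g (f τ) τ := fun τ =>
    intervalIntegral.integral_hasDerivAt_right (hf.intervalIntegrable _ _)
      hf.stronglyMeasurable.stronglyMeasurableAtFilter hf.continuousAt
  have hgc : Continuous g := continuous_iff_continuousAt.2 fun τ => (hgd τ).continuousAt
  have hκ : ∀ τ : ℝ, HasDerivAt (fun τ : ℝ => (μ : ℂ) * φ (μ * (t - τ)))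
      (-(μ : ℂ) ^ 2 * φ' (μ * (t - τ))) τ := by
    intro τ
    have h1 : HasDerivAt (fun τ : ℝ => μ * (t - τ)) (μ * -1) τ :=
      ((hasDerivAt_id τ).const_sub t).const_mul μ
    have h2 : HasDerivAt φ (φ' (μ * (t - τ))) (μ * (t - τ)) := by
      rw [hφ', SchwartzMap.derivCLM_apply]
      exact φ.differentiableAt.hasDerivAt
    have h3 := (h2.scomp τ h1).const_mul (μ : ℂ)
    convert! h3 using 1
    rw [Complex.real_smul]; push_cast; ring
  have hgK : ∀ᵐ τ ∂(volume.restrict (Ioi (0 : ℝ))), ‖g τ‖ ≤ K' :=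
    (ae_restrict_iff' measurableSet_Ioi).2 (ae_of_all _ fun τ hτ => hK' τ (le_of_lt hτ))
  have hi1 : IntegrableOn (fun τ : ℝ => (-(μ : ℂ) ^ 2 * φ' (μ * (t - τ))) • g τ) (Ioi 0) :=
    ((integrable_dilate φ'.integrable hμ t).const_mul _).integrableOn.smul_bdd K'
      hgc.aestronglyMeasurable hgK
  have hi2 := (integrable_kernel_smul φ hμ t hf hK).integrableOn (s := Ioi (0 : ℝ))
  have hlim : Tendsto (fun τ : ℝ => ((μ : ℂ) * φ (μ * (t - τ))) • g τ) atTop (𝓝 0) := by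
    have h1 : Tendsto (fun τ : ℝ => (μ : ℂ) * φ (μ * (t - τ))) atTop (𝓝 0) := by
      have h3 : Tendsto (fun τ : ℝ => μ * (t - τ)) atTop atBot :=
        (tendsto_atBot_add_const_left _ t tendsto_neg_atTop_atBot).const_mul_atBot hμ
      have h2 : Tendsto φ (cocompact ℝ) (𝓝 0) := zero_at_infty φ
      have := ((h2.mono_left atBot_le_cocompact).comp h3).const_mul (μ : ℂ)
      simpa using this
    refine squeeze_zero_norm' (a := fun τ : ℝ => ‖(μ : ℂ) * φ (μ * (t - τ))‖ * K') ?_ ?_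
    · filter_upwards [eventually_ge_atTop 0] with τ hτ
      rw [norm_smul]
      exact mul_le_mul_of_nonneg_left (hK' τ hτ) (norm_nonneg _)
    · simpa using h1.norm.mul_const K'
  -- Integration by parts on (0, ∞): the boundary terms vanish, at 0 because the primitive does and
  -- at infinity because φ decays. Differentiating the kernel costs μ², and the change of variables
  -- gives back 1/μ.
  have key := integral_Ioi_of_hasDerivAt_of_tendsto (a := 0)
    (f := fun τ : ℝ => ((μ : ℂ) * φ (μ * (t - τ))) • g τ)
    (by
      refine Continuous.continuousWithinAt ?_
      exact (continuous_const.mul (φ.continuous.comp (by fun_prop))).smul hgc)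
    (fun τ _ => (hκ τ).smul (hgd τ)) (hi2.add hi1) hlim
  rw [integral_add hi2 hi1] at key
  have hg0 : g 0 = 0 := by simp [hg]
  rw [hg0, smul_zero, sub_zero] at key
  have h5 : mollify φ μ f t = -∫ τ in Ioi (0 : ℝ), (-(μ : ℂ) ^ 2 * φ' (μ * (t - τ))) • g τ :=
    eq_neg_of_add_eq_zero_left key
  rw [h5, norm_neg]
  have hi3 : Integrable fun τ : ℝ => μ ^ 2 * ‖φ' (μ * (t - τ))‖ * K' :=
    ((integrable_dilate φ'.integrable.norm hμ t).const_mul _).mul_const _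
  have hK'0 : 0 ≤ K' := (norm_nonneg _).trans (hK' 0 le_rfl)
  calc _ ≤ ∫ τ in Ioi (0 : ℝ), μ ^ 2 * ‖φ' (μ * (t - τ))‖ * K' := by
        refine norm_integral_le_of_norm_le hi3.integrableOn ?_
        filter_upwards [hgK] with τ hτ
        rw [norm_smul, norm_mul, norm_neg, norm_pow, Complex.norm_real, Real.norm_of_nonneg hμ.le]
        gcongr
    _ ≤ ∫ τ, μ ^ 2 * ‖φ' (μ * (t - τ))‖ * K' :=
        setIntegral_le_integral hi3 (ae_of_all _ fun τ => by positivity)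
    _ = _ := by
        rw [integral_mul_const, integral_const_mul, integral_dilate (fun u => ‖φ' u‖) hμ,
          smul_eq_mul]
        field_simp

/-! ### Cutoff functions and their kernels -/

/-- A smooth function equal to `1` on `[-1, 1]` and to `0` off `[-2, 2]`. -/
def cutoff : ContDiffBump (0 : ℝ) := ⟨1, 2, one_pos, one_lt_two⟩

/-- The difference of two dilated cutoff functions; it vanishes near `0` and far away. -/
def bandCutoff (r R s : ℝ) : ℝ := cutoff (2 / R * s) - cutoff (r⁻¹ * s)

theorem cutoff_eq_one {x : ℝ} (hx : |x| ≤ 1) : cutoff x = 1 :=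
  cutoff.one_of_mem_closedBall (by simpa [cutoff] using hx)

theorem cutoff_eq_zero {x : ℝ} (hx : 2 ≤ |x|) : cutoff x = 0 :=
  cutoff.zero_of_le_dist (by simpa [cutoff] using hx)

theorem contDiff_cutoff {n : ℕ∞} : ContDiff ℝ n cutoff := cutoff.contDiff

theorem contDiff_bandCutoff (r R : ℝ) {n : ℕ∞} : ContDiff ℝ n (bandCutoff r R) :=
  (contDiff_cutoff.comp (contDiff_const.mul contDiff_id)).sub
    (contDiff_cutoff.comp (contDiff_const.mul contDiff_id))

theorem bandCutoff_eq_zero_of_le {r R s : ℝ} (hr : 0 < r) (hR : 0 < R) (h1 : |s| ≤ r)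
    (h2 : 2 * |s| ≤ R) : bandCutoff r R s = 0 := by
  rw [bandCutoff, cutoff_eq_one, cutoff_eq_one, sub_self]
  · rw [abs_mul, abs_of_pos (inv_pos.2 hr), ← div_eq_inv_mul]
    exact (div_le_one hr).2 h1
  · rw [abs_mul, abs_of_pos (by positivity : 0 < 2 / R), div_mul_eq_mul_div]
    exact (div_le_one hR).2 h2

theorem bandCutoff_eq_zero_of_ge {r R s : ℝ} (hr : 0 < r) (hR : 0 < R) (h1 : 2 * r ≤ |s|)
    (h2 : R ≤ |s|) : bandCutoff r R s = 0 := by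
  rw [bandCutoff, cutoff_eq_zero, cutoff_eq_zero, sub_self]
  · rw [abs_mul, abs_of_pos (inv_pos.2 hr), ← div_eq_inv_mul]
    exact (le_div_iff₀ hr).2 h1
  · rw [abs_mul, abs_of_pos (by positivity : 0 < 2 / R), div_mul_eq_mul_div]
    exact (le_div_iff₀ hR).2 (by linarith)

/-- The complex-valued cutoff as a Schwartz function. -/
def cutoffSchwartz : 𝓢(ℝ, ℂ) :=
  HasCompactSupport.toSchwartzMap (f := fun x => ((cutoff x : ℝ) : ℂ))
    (cutoff.hasCompactSupport.comp_left Complex.ofReal_zero)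
    (Complex.ofRealCLM.contDiff.comp contDiff_cutoff)

theorem cutoffSchwartz_apply (x : ℝ) : cutoffSchwartz x = ((cutoff x : ℝ) : ℂ) := rfl

/-- The inverse Fourier transform of the cutoff function. -/
def kernel : 𝓢(ℝ, ℂ) := 𝓕⁻ cutoffSchwartz

theorem integral_kernel : ∫ u, kernel u = 1 := by
  have h : 𝓕 kernel = cutoffSchwartz := FourierTransform.fourier_fourierInv_eq _
  have h0 : (𝓕 kernel) 0 = 1 := by
    rw [h, cutoffSchwartz_apply, cutoff_eq_one (by simp), Complex.ofReal_one]
  rw [← h0, SchwartzMap.fourier_coe, Real.fourier_real_eq]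
  simp

/-- The Fourier transform is normalised with e^{2πi}, so the frequency cutoff at scale l corresponds
to the mollifier at scale μ = l/(2π). -/
theorem kernel_dilate {l : ℝ} (hl : 0 < l) (u : ℝ) :
    ((l / (2 * Real.pi) : ℝ) : ℂ) * kernel (l / (2 * Real.pi) * u) =
      (2 * Real.pi : ℂ)⁻¹ *
        ∫ s : ℝ, Complex.exp (Complex.I * s * u) * ((cutoff (l⁻¹ * s) : ℝ) : ℂ) := by
  have h1 : kernel (l / (2 * Real.pi) * u) =
      ∫ v : ℝ, Complex.exp (Complex.I * (l * v : ℝ) * u) * ((cutoff v : ℝ) : ℂ) := by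
    rw [kernel, SchwartzMap.fourierInv_coe, Real.fourierInv_eq']
    congr 1 with v
    rw [cutoffSchwartz_apply, smul_eq_mul]
    congr 2
    have : (Real.pi : ℂ) ≠ 0 := by exact_mod_cast Real.pi_ne_zero
    simp
    field_simp
  have h2 : (∫ s : ℝ, Complex.exp (Complex.I * s * u) * ((cutoff (l⁻¹ * s) : ℝ) : ℂ)) =
      ∫ s : ℝ, (fun v : ℝ => Complex.exp (Complex.I * (l * v : ℝ) * u) * ((cutoff v : ℝ) : ℂ))
        (l⁻¹ * s) := by
    congr 1 with s
    simp only [mul_inv_cancel_left₀ hl.ne']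
  rw [h1, h2, Measure.integral_comp_mul_left (fun v : ℝ =>
    Complex.exp (Complex.I * (l * v : ℝ) * u) * ((cutoff v : ℝ) : ℂ)), inv_inv, abs_of_pos hl, Complex.real_smul]
  push_cast
  ring

/-! ### From the boundary function to an oscillatory integral -/

theorem tsupport_subset_compl_zero {χ : ℝ → ℂ} {r : ℝ} (hr : 0 < r)
    (h : ∀ s, |s| ≤ r → χ s = 0) : tsupport χ ⊆ ({0} : Set ℝ)ᶜ := by
  have h1 : Function.support χ ⊆ {s : ℝ | r ≤ |s|} := by
    intro s hs
    by_contra hlt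
    exact hs (h s (not_le.1 hlt).le)
  have h2 : tsupport χ ⊆ {s : ℝ | r ≤ |s|} :=
    closure_minimal h1 (isClosed_le continuous_const continuous_abs)
  intro s hs h0
  have := h2 hs
  simp only [mem_ofPred_eq, mem_singleton_iff.1 h0, abs_zero] at this
  linarith

/-- Convolving `f` with the inverse Fourier transform of `χ` amounts to multiplying the boundary
function by `χ`. -/
theorem integral_kernel_eq_of_isBoundaryFunction [CompleteSpace X] {f : ℝ → X}
    (hf : Continuous f) {B : ℝ} (hB : ∀ t, ‖f t‖ ≤ B) {S : Set ℝ} {F : ℝ → X}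
    (hF : IsBoundaryFunction f S F) {χ : ℝ → ℂ} (hχ : Continuous χ) (hχc : HasCompactSupport χ)
    (hχS : tsupport χ ⊆ Sᶜ) {K : ℝ → ℂ} (hKi : Integrable K)
    (hK : ∀ u : ℝ, K u = (2 * Real.pi : ℂ)⁻¹ * ∫ s : ℝ, Complex.exp (Complex.I * s * u) * χ s)
    (t : ℝ) :
    ∫ τ in Ioi (0 : ℝ), K (t - τ) • f τ =
      (2 * Real.pi : ℂ)⁻¹ • ∫ s : ℝ, (Complex.exp (Complex.I * s * t) * χ s) • F s := by
  have hχi : Integrable χ := hχ.integrable_of_hasCompactSupport hχc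
  -- Abel regularisation: damp `f` by e^{-ατ}. As α → 0+ the damped convolution converges by
  -- dominated convergence, and for α > 0 Fubini rewrites it as a test of the Laplace transform on
  -- the line Re z = α.
  have hlim1 : Tendsto (fun α : ℝ =>
      ∫ τ in Ioi (0 : ℝ), K (t - τ) • (Complex.exp (-(α : ℂ) * τ) • f τ)) (𝓝[>] 0)
      (𝓝 (∫ τ in Ioi (0 : ℝ), K (t - τ) • f τ)) := by
    have hKt : Integrable fun τ => K (t - τ) := hKi.comp_sub_left t
    refine tendsto_integral_filter_of_dominated_convergence (fun τ => ‖K (t - τ)‖ * B) ?_ ?_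
      (hKt.norm.mul_const B).integrableOn ?_
    · refine Eventually.of_forall fun α => ?_
      exact hKt.aestronglyMeasurable.restrict.smul
        (Continuous.aestronglyMeasurable (by fun_prop))
    · filter_upwards [self_mem_nhdsWithin] with α hα
      refine (ae_restrict_iff' measurableSet_Ioi).2 (ae_of_all _ fun τ hτ => ?_)
      have h1 : ‖Complex.exp (-(α : ℂ) * τ)‖ ≤ 1 := by
        rw [Complex.norm_exp, Real.exp_le_one_iff]
        have h2 : 0 < α * τ := mul_pos hα hτ
        simp
        linarith
      rw [norm_smul, norm_smul]
      gcongr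
      calc _ ≤ 1 * B := by gcongr; exact hB τ
        _ = B := one_mul B
    · refine ae_of_all _ fun τ => ?_
      have h1 : Tendsto (fun α : ℝ => Complex.exp (-(α : ℂ) * τ)) (𝓝[>] 0) (𝓝 1) := by
        have : Continuous fun α : ℝ => Complex.exp (-(α : ℂ) * τ) := by fun_prop
        have h2 := (this.tendsto 0).mono_left (nhdsWithin_le_nhds (s := Ioi 0))
        simpa using h2
      simpa using (h1.smul_const (f τ)).const_smul (K (t - τ))
  have hlim2 := (hF.2 (fun s => Complex.exp (Complex.I * s * t) * χ s) (by fun_prop)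
    hχc.mul_left ((tsupport_mul_subset_right).trans hχS)).const_smul (2 * Real.pi : ℂ)⁻¹
  refine tendsto_nhds_unique (hlim1.congr' ?_) hlim2
  filter_upwards [self_mem_nhdsWithin] with α hα
  have hα0 : (0 : ℝ) < α := hα
  have hfi : IntegrableOn (fun τ : ℝ => Complex.exp (-(α : ℂ) * τ) • f τ) (Ioi 0) := by
    have h1 : IntegrableOn (fun τ : ℝ => Complex.exp (-(α : ℂ) * τ)) (Ioi 0) :=
      integrableOn_exp_mul_complex_Ioi (by simpa using hα0) 0
    exact h1.smul_bdd B hf.aestronglyMeasurable (ae_of_all _ hB)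
  have hprod : Integrable (Function.uncurry fun (s τ : ℝ) =>
      Complex.exp (Complex.I * s * (t - τ)) • χ s • (Complex.exp (-(α : ℂ) * τ) • f τ))
      (volume.prod (volume.restrict (Ioi (0 : ℝ)))) := by
    refine (Integrable.smul_prod hχi hfi).bdd_smul 1
      (Continuous.aestronglyMeasurable (by fun_prop)) (ae_of_all _ fun z => ?_)
    rw [Complex.norm_exp]
    simp
  have hswap := integral_integral_swap hprod
  have hl : ∀ τ : ℝ, K (t - τ) • (Complex.exp (-(α : ℂ) * τ) • f τ) = (2 * Real.pi : ℂ)⁻¹ •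
      ∫ s : ℝ, Complex.exp (Complex.I * s * (t - τ)) • χ s •
        (Complex.exp (-(α : ℂ) * τ) • f τ) := by
    intro τ
    rw [hK, mul_smul, ← integral_smul_const]
    congr 2 with s
    rw [mul_smul]
    push_cast
    rfl
  simp only [hl]
  rw [integral_smul, ← hswap]
  congr 2 with s
  rw [laplace, ← integral_smul]
  refine integral_congr_ae (ae_of_all _ fun τ => ?_)
  simp only [smul_smul]
  congr 1
  rw [mul_comm (χ s), ← mul_assoc, ← Complex.exp_add,
    mul_right_comm (Complex.exp (Complex.I * s * t)), ← Complex.exp_add]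
  congr 2
  ring

/-- Split `f` into the high-scale error, the low-scale mollification and the difference of the two
mollifications, the last being the oscillatory integral. Both r and R are still free, to be
optimised against t. -/
theorem norm_le_add_norm_integral_bandCutoff [CompleteSpace X] {f : ℝ → X}
    (hf : Continuous f) {K : ℝ} (hK : ∀ t, ‖f t‖ ≤ K) {L : ℝ≥0} (hL : LipschitzWith L f)
    {K' : ℝ} (hK' : ∀ t : ℝ, 0 ≤ t → ‖∫ s in (0 : ℝ)..t, f s‖ ≤ K') {F : ℝ → X}
    (hF : IsBoundaryFunction f {0} F) :
    ∃ A : ℝ, 0 < A ∧ ∀ r > 0, ∀ R > 0, ∀ t ≥ 1, ‖f t‖ ≤ A * (r + 1 / R) +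
      ‖∫ s : ℝ, (Complex.exp (Complex.I * s * t) * (bandCutoff r R s : ℝ)) • F s‖ := by
  obtain ⟨A₁, hA₁⟩ := norm_sub_mollify_le kernel integral_kernel hf hK hL
  obtain ⟨A₂, hA₂⟩ := norm_mollify_le kernel hf hK hK'
  have hpi := Real.pi_gt_three
  -- The scales are μ = (R/2)/(2π) and μ = r/(2π), whence the factors 4π and 1/(2π); the 1 only
  -- makes the constant positive.
  refine ⟨max (max (A₁ * (4 * Real.pi)) (A₂ / (2 * Real.pi))) 1, by positivity,
    fun r hr R hR t ht => ?_⟩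
  have h1 := hA₁ ((R / 2) / (2 * Real.pi)) (by positivity) t ht
  have h2 := hA₂ (r / (2 * Real.pi)) (by positivity) t
  set k : ℝ → ℝ → ℂ := fun l u => ((l / (2 * Real.pi) : ℝ) : ℂ) * kernel (l / (2 * Real.pi) * u)
    with hk
  have hki : ∀ l > 0, Integrable (k l) := fun l hl =>
    ((integrable_comp_mul_left_iff (fun u => kernel u) (by positivity)).2
      kernel.integrable).const_mul _
  have hχ : Continuous fun s : ℝ => ((bandCutoff r R s : ℝ) : ℂ) :=
    Complex.continuous_ofReal.comp (contDiff_bandCutoff r R (n := 0)).continuous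
  have hχc : HasCompactSupport fun s : ℝ => ((bandCutoff r R s : ℝ) : ℂ) := by
    refine HasCompactSupport.intro (isCompact_Icc (a := -(2 * r + R)) (b := 2 * r + R))
      fun s hs => ?_
    have : 2 * r + R ≤ |s| := by
      by_contra! h
      exact hs ⟨(abs_lt.1 h).1.le, (abs_lt.1 h).2.le⟩
    rw [bandCutoff_eq_zero_of_ge hr hR (by linarith) (by linarith), Complex.ofReal_zero]
  have hint : ∀ l > 0, ∀ u : ℝ, Integrable fun s : ℝ =>
      Complex.exp (Complex.I * s * u) * ((cutoff (l⁻¹ * s) : ℝ) : ℂ) := by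
    intro l hl u
    refine ((integrable_comp_mul_left_iff (fun s => cutoffSchwartz s)
      (inv_pos.2 hl).ne').2 cutoffSchwartz.integrable).bdd_mul (c := 1)
      (Continuous.aestronglyMeasurable (by fun_prop)) (ae_of_all _ fun s => ?_)
    rw [Complex.norm_exp]
    simp
  have hrep := integral_kernel_eq_of_isBoundaryFunction hf hK hF hχ hχc
    -- No relation between r and R is assumed here: the band cutoff is 1 - 1 where both of its terms
    -- are on their plateau.
    (tsupport_subset_compl_zero (r := min r (R / 2)) (by positivity) fun s hs => by
      rw [bandCutoff_eq_zero_of_le hr hR (hs.trans (min_le_left _ _))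
        (by linarith [hs.trans (min_le_right _ _)]), Complex.ofReal_zero])
    (K := fun u => k (R / 2) u - k r u) ((hki _ (by positivity)).sub (hki _ hr))
    (fun u => by
      rw [hk]
      simp only
      rw [kernel_dilate (by positivity), kernel_dilate hr, ← mul_sub,
        ← integral_sub (hint _ (by positivity) u) (hint _ hr u)]
      congr 2 with s
      rw [← mul_sub, bandCutoff, inv_div]
      push_cast
      rfl) t
  have hsub : ∫ τ in Ioi (0 : ℝ), (k (R / 2) (t - τ) - k r (t - τ)) • f τ =
      mollify kernel ((R / 2) / (2 * Real.pi)) f t - mollify kernel (r / (2 * Real.pi)) f t := by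
    rw [mollify, mollify, ← integral_sub
      (integrable_kernel_smul kernel (by positivity) t hf hK).integrableOn
      (integrable_kernel_smul kernel (by positivity) t hf hK).integrableOn]
    simp only [sub_smul, hk]
  rw [hsub] at hrep
  set a := mollify kernel ((R / 2) / (2 * Real.pi)) f t
  set b := mollify kernel (r / (2 * Real.pi)) f t
  set I := ∫ s : ℝ, (Complex.exp (Complex.I * s * t) * (bandCutoff r R s : ℝ)) • F s with hI
  have h3 : ‖(2 * Real.pi : ℂ)⁻¹ • I‖ ≤ ‖I‖ := by
    have h4 : ‖(2 * Real.pi : ℂ)⁻¹‖ ≤ 1 := by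
      rw [norm_inv]
      refine inv_le_one_of_one_le₀ ?_
      rw [norm_mul, Complex.norm_real, Real.norm_of_nonneg Real.pi_pos.le]
      norm_num
      linarith
    rw [norm_smul]
    exact mul_le_of_le_one_left (norm_nonneg _) h4
  have h5 : f t = (f t - a) + b + (a - b) := by abel
  calc ‖f t‖ = ‖(f t - a) + b + (a - b)‖ := by rw [← h5]
    _ ≤ ‖f t - a‖ + ‖b‖ + ‖a - b‖ := norm_add₃_le
    _ ≤ A₁ * (4 * Real.pi) * (1 / R) + A₂ / (2 * Real.pi) * r + ‖I‖ := by
        refine add_le_add (add_le_add (h1.trans_eq ?_) (h2.trans_eq ?_)) (hrep ▸ h3)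
        · field_simp; ring
        · field_simp
    _ ≤ _ := by
        have h6 := le_max_left (max (A₁ * (4 * Real.pi)) (A₂ / (2 * Real.pi))) 1
        have h7 := (le_max_left (A₁ * (4 * Real.pi)) (A₂ / (2 * Real.pi))).trans h6
        have h8 := (le_max_right (A₁ * (4 * Real.pi)) (A₂ / (2 * Real.pi))).trans h6
        have h9 : 0 < 1 / R := by positivity
        nlinarith [mul_le_mul_of_nonneg_right h7 h9.le, mul_le_mul_of_nonneg_right h8 hr.le]

/-- Ingham's theorem, with `{0}` as the set of singularities. -/
theorem tendsto_zero_of_isBoundaryFunction [CompleteSpace X] {f : ℝ → X}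
    (hf : Continuous f) {K : ℝ} (hK : ∀ t, ‖f t‖ ≤ K) {L : ℝ≥0} (hL : LipschitzWith L f)
    {K' : ℝ} (hK' : ∀ t : ℝ, 0 ≤ t → ‖∫ s in (0 : ℝ)..t, f s‖ ≤ K') {F : ℝ → X}
    (hF : IsBoundaryFunction f {0} F) : Tendsto f atTop (𝓝 0) := by
  obtain ⟨A, hA0, hA⟩ := norm_le_add_norm_integral_bandCutoff hf hK hL hK' hF
  rw [tendsto_zero_iff_norm_tendsto_zero]
  refine tendsto_order.2 ⟨fun a ha => Eventually.of_forall fun t => ha.trans_le (norm_nonneg _),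
    fun ε hε => ?_⟩
  -- Riemann–Lebesgue with r and R chosen so that A (r + 1/R) = ε/2. Integrability need not be
  -- checked: a non-integrable integrand has all these integrals equal to 0.
  have hRL := Real.tendsto_integral_exp_smul_cocompact
    (fun s => ((bandCutoff (ε / (4 * A)) (4 * A / ε) s : ℝ) : ℂ) • F s)
  have hlim : Tendsto (fun t : ℝ => -(t / (2 * Real.pi))) atTop (cocompact ℝ) :=
    (tendsto_neg_atTop_atBot.comp (tendsto_id.atTop_div_const (by positivity))).mono_right
      atBot_le_cocompact
  have h1 := ((hRL.comp hlim).norm).eventually_lt_const (u := ε / 2) (by simpa using hε)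
  filter_upwards [h1, eventually_ge_atTop 1] with t h1 ht
  refine (hA (ε / (4 * A)) (by positivity) (4 * A / ε) (by positivity) t ht).trans_lt ?_
  have h2 : A * (ε / (4 * A) + 1 / (4 * A / ε)) = ε / 2 := by field_simp; ring
  have h3 : ∫ s : ℝ, (Complex.exp (Complex.I * s * t) *
      (bandCutoff (ε / (4 * A)) (4 * A / ε) s : ℝ)) • F s =
      ∫ s : ℝ, Real.fourierChar (-(s * -(t / (2 * Real.pi)))) •
        ((bandCutoff (ε / (4 * A)) (4 * A / ε) s : ℝ) : ℂ) • F s := by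
    congr 1 with s
    rw [mul_smul, Circle.smul_def, Real.fourierChar_apply]
    congr 2
    push_cast
    have : (Real.pi : ℂ) ≠ 0 := by exact_mod_cast Real.pi_ne_zero
    field_simp
  rw [h2, h3]
  simp only [Function.comp] at h1
  linarith

/-! ### Inverse functions and the growth of `m_k`, `m_log`, `M_k`, `M_log` -/

section Inverses

variable {g : ℝ → ℝ}

/-- By the intermediate value theorem and unboundedness near 0, large arguments lie in the range,
where `lowerInv` is a true inverse; monotonicity then forces its values towards 0. -/
theorem eventually_lowerInv (hcont : ContinuousOn g (Ioc 0 1)) (hanti : StrictAntiOn g (Ioc 0 1))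
    (hinf : ∀ y, ∃ r ∈ Ioc (0 : ℝ) 1, y ≤ g r) {c ε : ℝ} (hc : 0 < c) (hε : 0 < ε) :
    ∀ᶠ t in atTop, lowerInv g (c * t) ∈ Ioc 0 1 ∧ lowerInv g (c * t) ≤ ε ∧
      g (lowerInv g (c * t)) = c * t := by
  have hlim : Tendsto (fun t : ℝ => c * t) atTop atTop := tendsto_id.const_mul_atTop hc
  have hε1 : min ε 1 ∈ Ioc (0 : ℝ) 1 := ⟨by positivity, min_le_right _ _⟩
  filter_upwards [hlim.eventually_ge_atTop (g 1), hlim.eventually_gt_atTop (g (min ε 1))]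
    with t h1 h2
  obtain ⟨a, ha, hya⟩ := hinf (c * t)
  have hsub : Icc a 1 ⊆ Ioc 0 1 := fun x hx => ⟨ha.1.trans_le hx.1, hx.2⟩
  obtain ⟨r, hr, hgr⟩ := intermediate_value_Icc' ha.2 (hcont.mono hsub) ⟨h1, hya⟩
  have hex : ∃ x ∈ Ioc (0 : ℝ) 1, g x = c * t := ⟨r, hsub hr, hgr⟩
  have hmem : lowerInv g (c * t) ∈ Ioc 0 1 := Function.invFunOn_mem hex
  have heq : g (lowerInv g (c * t)) = c * t := Function.invFunOn_eq hex
  refine ⟨hmem, ?_, heq⟩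
  by_contra! hlt
  have := hanti hε1 hmem ((min_le_left _ _).trans_lt hlt)
  linarith

theorem eventually_upperInv (hcont : ContinuousOn g (Ici 1)) (hmono : StrictMonoOn g (Ici 1))
    (hinf : ∀ y, ∃ R ∈ Ici (1 : ℝ), y ≤ g R) {c : ℝ} (hc : 0 < c) (N : ℝ) :
    ∀ᶠ t in atTop, upperInv g (c * t) ∈ Ici 1 ∧ N ≤ upperInv g (c * t) ∧
      g (upperInv g (c * t)) = c * t := by
  have hlim : Tendsto (fun t : ℝ => c * t) atTop atTop := tendsto_id.const_mul_atTop hc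
  have hN1 : max N 1 ∈ Ici (1 : ℝ) := mem_Ici.2 (le_max_right N 1)
  filter_upwards [hlim.eventually_ge_atTop (g 1), hlim.eventually_gt_atTop (g (max N 1))]
    with t h1 h2
  obtain ⟨a, ha, hya⟩ := hinf (c * t)
  have hsub : Icc 1 a ⊆ Ici 1 := fun x hx => hx.1
  obtain ⟨r, hr, hgr⟩ := intermediate_value_Icc ha (hcont.mono hsub) ⟨h1, hya⟩
  have hex : ∃ x ∈ Ici (1 : ℝ), g x = c * t := ⟨r, hsub hr, hgr⟩
  have hmem : upperInv g (c * t) ∈ Ici 1 := Function.invFunOn_mem hex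
  have heq : g (upperInv g (c * t)) = c * t := Function.invFunOn_eq hex
  refine ⟨hmem, ?_, heq⟩
  by_contra! hlt
  have := hmono hmem hN1 (hlt.trans_le (le_max_left _ _))
  linarith

end Inverses

section Growth

variable {m M : ℝ → ℝ} {k : ℕ}

theorem continuousOn_lowerK (hm : ContinuousOn m (Ioc 0 1)) :
    ContinuousOn (lowerK m k) (Ioc 0 1) :=
  hm.mul ((hm.div continuousOn_id fun _ hr => hr.1.ne').rpow_const fun _ _ =>
    Or.inr (by positivity))

theorem continuousOn_lowerLog (hm : ContinuousOn m (Ioc 0 1)) (hm1 : ∀ r ∈ Ioc (0 : ℝ) 1, 1 ≤ m r) :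
    ContinuousOn (lowerLog m) (Ioc 0 1) := by
  refine hm.mul ((continuousOn_const.add
    (hm.div continuousOn_id fun _ hr => hr.1.ne')).log fun r hr => ?_)
  have := hm1 r hr
  have := hr.1
  have : 0 < m r / r := by positivity
  exact (by linarith : 0 < 1 + m r / r).ne'

theorem continuousOn_upperK (hM : ContinuousOn M (Ici 1)) :
    ContinuousOn (upperK M k) (Ici 1) :=
  hM.mul ((((continuousOn_const.add continuousOn_id).pow 2).mul hM).rpow_const fun _ _ =>
    Or.inr (by positivity))

theorem continuousOn_upperLog (hM : ContinuousOn M (Ici 1)) (hM1 : ∀ R ∈ Ici (1 : ℝ), 1 ≤ M R) :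
    ContinuousOn (upperLog M) (Ici 1) := by
  refine hM.mul (((continuousOn_const.add continuousOn_id).log fun R hR => ?_).add
    (hM.log fun R hR => ?_))
  · have : (1 : ℝ) ≤ R := hR
    exact (by linarith : 0 < 1 + R).ne'
  · linarith [hM1 R hR]

theorem exists_le_lowerK (hm1 : ∀ r ∈ Ioc (0 : ℝ) 1, 1 ≤ m r) (hk : 1 ≤ k) (y : ℝ) :
    ∃ r ∈ Ioc (0 : ℝ) 1, y ≤ lowerK m k r := by
  have hy1 : 1 ≤ max y 1 := le_max_right _ _
  -- Since m ≥ 1, this r makes (m(r)/r)^{1/k} at least max y 1.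
  have hr : ((max y 1) ^ k)⁻¹ ∈ Ioc (0 : ℝ) 1 :=
    ⟨by positivity, inv_le_one_of_one_le₀ (one_le_pow₀ hy1)⟩
  refine ⟨_, hr, ?_⟩
  have h1 := hm1 _ hr
  set r := ((max y 1) ^ k)⁻¹ with hrdef
  have h2 : (max y 1) ^ k ≤ m r / r := by
    rw [hrdef, div_inv_eq_mul, ← hrdef]
    exact le_mul_of_one_le_left (by positivity) h1
  have h3 : max y 1 ≤ (m r / r) ^ (1 / (k : ℝ)) := by
    calc max y 1 = ((max y 1) ^ k) ^ (1 / (k : ℝ)) := by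
          rw [one_div, Real.pow_rpow_inv_natCast (by positivity) (by omega)]
      _ ≤ _ := Real.rpow_le_rpow (by positivity) h2 (by positivity)
  calc y ≤ max y 1 := le_max_left _ _
    _ ≤ (m r / r) ^ (1 / (k : ℝ)) := h3
    _ ≤ _ := le_mul_of_one_le_left (by linarith) h1

theorem exists_le_lowerLog (hm1 : ∀ r ∈ Ioc (0 : ℝ) 1, 1 ≤ m r) (y : ℝ) :
    ∃ r ∈ Ioc (0 : ℝ) 1, y ≤ lowerLog m r := by
  have hr : Real.exp (-max y 0) ∈ Ioc (0 : ℝ) 1 :=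
    ⟨Real.exp_pos _, Real.exp_le_one_iff.2 (by simp)⟩
  refine ⟨_, hr, ?_⟩
  have h1 := hm1 _ hr
  set r := Real.exp (-max y 0) with hrdef
  have h2 : Real.exp (max y 0) ≤ m r / r := by
    rw [hrdef, Real.exp_neg, div_inv_eq_mul, ← Real.exp_neg, ← hrdef]
    exact le_mul_of_one_le_left (Real.exp_pos _).le h1
  have h3 : max y 0 ≤ Real.log (1 + m r / r) := by
    have := Real.exp_pos (max y 0)
    rw [Real.le_log_iff_exp_le (by linarith)]
    linarith
  calc y ≤ max y 0 := le_max_left _ _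
    _ ≤ _ := h3
    _ ≤ _ := le_mul_of_one_le_left ((le_max_right y 0).trans h3) h1

theorem exists_le_upperK (hM1 : ∀ R ∈ Ici (1 : ℝ), 1 ≤ M R) (hk : 1 ≤ k) (y : ℝ) :
    ∃ R ∈ Ici (1 : ℝ), y ≤ upperK M k R := by
  have hy1 : 1 ≤ max y 1 := le_max_right _ _
  have hR : (max y 1) ^ k ∈ Ici (1 : ℝ) := one_le_pow₀ hy1
  refine ⟨_, hR, ?_⟩
  have h1 := hM1 _ hR
  set R := (max y 1) ^ k with hRdef
  have hR1 : 1 ≤ R := hR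
  have h2 : R ≤ (1 + R) ^ 2 * M R := by nlinarith
  have h3 : max y 1 ≤ ((1 + R) ^ 2 * M R) ^ (1 / (k : ℝ)) := by
    calc max y 1 = R ^ (1 / (k : ℝ)) := by
          rw [one_div, hRdef, Real.pow_rpow_inv_natCast (by positivity) (by omega)]
      _ ≤ _ := Real.rpow_le_rpow (by positivity) h2 (by positivity)
  calc y ≤ max y 1 := le_max_left _ _
    _ ≤ _ := h3
    _ ≤ _ := le_mul_of_one_le_left (by linarith) h1

theorem exists_le_upperLog (hM1 : ∀ R ∈ Ici (1 : ℝ), 1 ≤ M R) (y : ℝ) :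
    ∃ R ∈ Ici (1 : ℝ), y ≤ upperLog M R := by
  have hR : Real.exp (max y 0) ∈ Ici (1 : ℝ) := Real.one_le_exp (le_max_right _ _)
  refine ⟨_, hR, ?_⟩
  have h1 := hM1 _ hR
  set R := Real.exp (max y 0) with hRdef
  have h3 : max y 0 ≤ Real.log (1 + R) := by
    have := Real.exp_pos (max y 0)
    rw [Real.le_log_iff_exp_le (by linarith)]
    linarith
  have h4 : 0 ≤ Real.log (M R) := Real.log_nonneg h1
  calc y ≤ max y 0 := le_max_left _ _
    _ ≤ Real.log (1 + R) + Real.log (M R) := by linarith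
    _ ≤ _ := le_mul_of_one_le_left (by linarith [le_max_right y 0]) h1

/-- The k-th power of the defining equation: with y = ct it says that m(r)^{k+1} / t^k is exactly
c^k r, which is why `m_k` is the right function. -/
theorem pow_succ_eq_of_lowerK_eq (hk : 1 ≤ k) {r y : ℝ} (hr : 0 < r) (hm : 0 < m r)
    (h : lowerK m k r = y) : m r ^ (k + 1) = y ^ k * r := by
  rw [← h, lowerK, mul_pow, one_div, Real.rpow_inv_natCast_pow (by positivity) (by omega)]
  field_simp
  ring

theorem pow_succ_eq_of_upperK_eq (hk : 1 ≤ k) {R y : ℝ} (hM : 0 < M R)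
    (h : upperK M k R = y) : (1 + R) ^ 2 * M R ^ (k + 1) = y ^ k := by
  rw [← h, upperK, mul_pow, one_div, Real.rpow_inv_natCast_pow (by positivity) (by omega)]
  ring

end Growth

/-! ### Finitely many derivatives: case (a) -/

theorem exists_abs_pow_mul_iteratedDeriv_cutoff_le (k l : ℕ) :
    ∃ B : ℝ, 0 < B ∧ ∀ x : ℝ, |x| ^ k * |iteratedDeriv l cutoff x| ≤ B := by
  obtain ⟨B, hB, h⟩ := (cutoff.hasCompactSupport.toSchwartzMap contDiff_cutoff).decay k l
  refine ⟨B, hB, fun x => ?_⟩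
  rw [← Real.norm_eq_abs, ← Real.norm_eq_abs, ← norm_iteratedFDeriv_eq_norm_iteratedDeriv]
  exact h x

theorem iteratedDeriv_bandCutoff (r R : ℝ) (l : ℕ) (s : ℝ) :
    iteratedDeriv l (bandCutoff r R) s = (2 / R) ^ l * iteratedDeriv l cutoff (2 / R * s) -
      r⁻¹ ^ l * iteratedDeriv l cutoff (r⁻¹ * s) := by
  have hc : ∀ a : ℝ, ContDiff ℝ l fun s : ℝ => cutoff (a * s) := fun a =>
    (contDiff_cutoff (n := l)).comp (contDiff_const.mul contDiff_id)
  have h := iteratedDeriv_fun_sub (n := l) (x := s) (hc (2 / R)).contDiffAt (hc r⁻¹).contDiffAt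
  rw [iteratedDeriv_comp_const_mul (contDiff_cutoff (n := l)),
    iteratedDeriv_comp_const_mul (contDiff_cutoff (n := l))] at h
  exact h

/-- The derivatives of order `l` of the band cutoffs are `O(|s|⁻ˡ)`, uniformly in the scales. -/
theorem exists_abs_pow_mul_iteratedDeriv_bandCutoff_le (l : ℕ) :
    ∃ B : ℝ, 0 < B ∧ ∀ r > 0, ∀ R > 0, ∀ s : ℝ,
      |s| ^ l * |iteratedDeriv l (bandCutoff r R) s| ≤ B := by
  obtain ⟨B, hB, h⟩ := exists_abs_pow_mul_iteratedDeriv_cutoff_le l l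
  refine ⟨2 * B, by positivity, fun r hr R hR s => ?_⟩
  have hscale : ∀ a > 0, |s| ^ l * |a ^ l * iteratedDeriv l cutoff (a * s)| ≤ B := by
    intro a ha
    refine le_of_eq_of_le ?_ (h (a * s))
    rw [abs_mul, abs_mul, mul_pow, abs_of_pos (pow_pos ha l), abs_of_pos ha]
    ring
  rw [iteratedDeriv_bandCutoff]
  calc _ ≤ |s| ^ l * (|(2 / R) ^ l * iteratedDeriv l cutoff (2 / R * s)| +
        |r⁻¹ ^ l * iteratedDeriv l cutoff (r⁻¹ * s)|) := by
        gcongr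
        exact abs_sub _ _
    _ ≤ 2 * B := by
        rw [mul_add]
        linarith [hscale (2 / R) (by positivity), hscale r⁻¹ (by positivity)]

/-- Integration by parts k times, read off from the Fourier transform of the k-th derivative at the
frequency -t/(2π); compact support removes the boundary terms. -/
theorem norm_integral_exp_smul_le {G : ℝ → X} {k : ℕ} (hG : ContDiff ℝ k G)
    (hGc : HasCompactSupport G) {t : ℝ} (ht : 0 < t) :
    ‖∫ s : ℝ, Complex.exp (Complex.I * s * t) • G s‖ ≤
      (∫ s, ‖iteratedDeriv k G s‖) / t ^ k := by
  have hi : ∀ n : ℕ, (n : ℕ∞) ≤ (k : ℕ∞) → Integrable (iteratedDeriv n G) := by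
    intro n hn
    refine (hG.continuous_iteratedDeriv n (by exact_mod_cast hn)).integrable_of_hasCompactSupport ?_
    refine HasCompactSupport.of_support_subset_isCompact hGc ?_
    intro s hs
    by_contra hns
    apply hs
    have h0 : G =ᶠ[𝓝 s] fun _ => 0 := notMem_tsupport_iff_eventuallyEq.1 hns
    rw [h0.iteratedDeriv_eq]
    simp
  have h := congrFun (Real.fourier_iteratedDeriv (N := k) (by exact_mod_cast hG) hi le_rfl)
    (-(t / (2 * Real.pi)))
  have hpi : (Real.pi : ℂ) ≠ 0 := by exact_mod_cast Real.pi_ne_zero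
  have h1 : FourierTransform.fourier G (-(t / (2 * Real.pi))) =
      ∫ s : ℝ, Complex.exp (Complex.I * s * t) • G s := by
    rw [Real.fourier_real_eq_integral_exp_smul]
    congr 1 with s
    congr 2
    push_cast
    field_simp
  have h2 : ‖(2 * Real.pi * Complex.I * ((-(t / (2 * Real.pi)) : ℝ) : ℂ)) ^ k‖ = t ^ k := by
    have : 2 * Real.pi * Complex.I * ((-(t / (2 * Real.pi)) : ℝ) : ℂ) = -(t * Complex.I) := by
      push_cast
      field_simp
    rw [this, norm_pow, norm_neg, norm_mul, Complex.norm_I, mul_one, Complex.norm_real,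
      Real.norm_of_nonneg ht.le]
  rw [le_div_iff₀ (by positivity), mul_comm, ← h2, ← h1, ← norm_smul, ← h,
    Real.fourier_real_eq_integral_exp_smul]
  refine (norm_integral_le_integral_norm _).trans_eq ?_
  congr 1 with s
  rw [norm_smul, Complex.norm_exp_ofReal_mul_I, one_mul]

theorem contDiff_bandCutoff_smul {F : ℝ → X} {n : ℕ∞} (hF : ContDiffOn ℝ n F {0}ᶜ) {r R : ℝ}
    (hr : 0 < r) (hR : 0 < R) : ContDiff ℝ n fun s => bandCutoff r R s • F s := by
  rw [contDiff_iff_contDiffAt]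
  intro s
  by_cases hs : s = 0
  · have h0 : (fun s => bandCutoff r R s • F s) =ᶠ[𝓝 s] fun _ => 0 := by
      have : Metric.ball (0 : ℝ) (min r (R / 2)) ∈ 𝓝 s := by
        rw [hs]
        exact Metric.ball_mem_nhds _ (by positivity)
      filter_upwards [this] with x hx
      rw [mem_ball_zero_iff, Real.norm_eq_abs, lt_min_iff] at hx
      rw [bandCutoff_eq_zero_of_le hr hR hx.1.le (by linarith [hx.2]), zero_smul]
    exact contDiffAt_const.congr_of_eventuallyEq h0
  · exact (contDiff_bandCutoff r R).contDiffAt.smul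
      (hF.contDiffAt (isOpen_compl_singleton.mem_nhds hs))

theorem norm_iteratedDeriv_bandCutoff_smul_le {F : ℝ → X} {k : ℕ}
    (hF : ContDiffOn ℝ k F {0}ᶜ) (r R : ℝ) {s : ℝ} (hs : s ≠ 0) :
    ‖iteratedDeriv k (fun s => bandCutoff r R s • F s) s‖ ≤
      ∑ i ∈ Finset.range (k + 1), (k.choose i : ℝ) * |iteratedDeriv i (bandCutoff r R) s| *
        ‖iteratedDeriv (k - i) F s‖ := by
  have hopen : IsOpen ({0}ᶜ : Set ℝ) := isOpen_compl_singleton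
  have hmem : s ∈ ({0}ᶜ : Set ℝ) := hs
  have h := norm_iteratedFDerivWithin_smul_le (𝕜 := ℝ) (𝕜' := ℝ) (n := k)
    (contDiff_bandCutoff r R (n := k)).contDiffOn hF hopen.uniqueDiffOn hmem le_rfl
  simp only [iteratedFDerivWithin_of_isOpen _ hopen hmem,
    norm_iteratedFDeriv_eq_norm_iteratedDeriv, Real.norm_eq_abs] at h
  exact h

theorem iteratedDeriv_bandCutoff_smul_eq_zero (F : ℝ → X) (k : ℕ) {r R s : ℝ} (hr : 0 < r)
    (hrR : 2 * r ≤ R) (hs : |s| < r ∨ R < |s|) :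
    iteratedDeriv k (fun s => bandCutoff r R s • F s) s = 0 := by
  have h0 : (fun s => bandCutoff r R s • F s) =ᶠ[𝓝 s] fun _ => 0 := by
    rcases hs with hs | hs
    · filter_upwards [continuous_abs.continuousAt.eventually_lt_const hs] with x hx
      rw [bandCutoff_eq_zero_of_le hr (by linarith) hx.le (by linarith), zero_smul]
    · filter_upwards [continuous_abs.continuousAt.eventually_const_lt hs] with x hx
      rw [bandCutoff_eq_zero_of_ge hr (by linarith) (by linarith) hx.le, zero_smul]
  rw [h0.iteratedDeriv_eq]
  simp

theorem hasCompactSupport_bandCutoff_smul (F : ℝ → X) {r R : ℝ} (hr : 0 < r) (hrR : 2 * r ≤ R) :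
    HasCompactSupport fun s => bandCutoff r R s • F s := by
  refine HasCompactSupport.intro (isCompact_Icc (a := -R) (b := R)) fun s hs => ?_
  have : R ≤ |s| := by
    by_contra! h
    exact hs ⟨(abs_lt.1 h).1.le, (abs_lt.1 h).2.le⟩
  rw [bandCutoff_eq_zero_of_ge hr (by linarith) (by linarith) this, zero_smul]

/-- The estimate of the oscillatory integral obtained by integrating by parts `k` times. -/
theorem exists_norm_integral_bandCutoff_le_of_contDiffOn {F : ℝ → X} {k : ℕ}
    (hF : ContDiffOn ℝ k F {0}ᶜ) {m M : ℝ → ℝ} (hm : AntitoneOn m (Ioc 0 1))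
    (hm1 : ∀ r ∈ Ioc (0 : ℝ) 1, 1 ≤ m r) (hM : MonotoneOn M (Ici 1))
    (hM1 : ∀ R ∈ Ici (1 : ℝ), 1 ≤ M R) {C : ℝ} (hC : 0 < C)
    (hlow : ∀ s : ℝ, 0 < |s| → |s| ≤ 1 → ∀ j : ℕ, j ≤ k →
      ‖iteratedDeriv j F s‖ ≤ C * |s| ^ (k - j) * m |s| ^ (k + 1))
    (hhigh : ∀ s : ℝ, 1 ≤ |s| → ∀ j : ℕ, j ≤ k →
      ‖iteratedDeriv j F s‖ ≤ C * M |s| ^ (j + 1)) :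
    ∃ D : ℝ, 0 < D ∧ ∀ r R t : ℝ, 0 < r → r ≤ 1 → 2 * r ≤ R → 1 ≤ R → 0 < t →
      ‖∫ s : ℝ, (Complex.exp (Complex.I * s * t) * (bandCutoff r R s : ℝ)) • F s‖ ≤
        D * (m r ^ (k + 1) + R * M R ^ (k + 1)) / t ^ k := by
  choose B hB0 hB using exists_abs_pow_mul_iteratedDeriv_bandCutoff_le
  set E : ℝ := ∑ i ∈ Finset.range (k + 1), (k.choose i : ℝ) * B i * C with hE
  have hE0 : 0 < E := by
    refine Finset.sum_pos (fun i hi => ?_) ⟨0, by simp⟩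
    have := hB0 i
    have : 0 < k.choose i := Nat.choose_pos (by simpa [Nat.lt_succ_iff] using hi)
    positivity
  -- E bounds the Leibniz sum; the factor 2 comes from the lengths 2 and 2R of [-1, 1] and [-R, R].
  refine ⟨2 * E, by positivity, fun r R t hr hr1 hrR hR1 ht => ?_⟩
  have hR0 : 0 < R := by linarith
  set G : ℝ → X := fun s => bandCutoff r R s • F s with hG
  have hmr : 1 ≤ m r := hm1 r ⟨hr, hr1⟩
  have hMR : 1 ≤ M R := hM1 R hR1
  have hpt : ∀ s : ℝ, ‖iteratedDeriv k G s‖ ≤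
      (Icc (-1 : ℝ) 1).indicator (fun _ => E * m r ^ (k + 1)) s +
        (Icc (-R) R).indicator (fun _ => E * M R ^ (k + 1)) s := by
    intro s
    have hi1 : 0 ≤ (Icc (-1 : ℝ) 1).indicator (fun _ => E * m r ^ (k + 1)) s :=
      indicator_nonneg (fun _ _ => by positivity) _
    have hi2 : 0 ≤ (Icc (-R) R).indicator (fun _ => E * M R ^ (k + 1)) s :=
      indicator_nonneg (fun _ _ => by positivity) _
    by_cases hout : |s| < r ∨ R < |s|
    · rw [hG, iteratedDeriv_bandCutoff_smul_eq_zero F k hr hrR hout, norm_zero]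
      exact add_nonneg hi1 hi2
    push Not at hout
    have hs0 : 0 < |s| := hr.trans_le hout.1
    have hbd : ∀ i, |iteratedDeriv i (bandCutoff r R) s| ≤ B i / |s| ^ i := by
      intro i
      rw [le_div_iff₀ (by positivity), mul_comm]
      exact hB i r hr R hR0 s
    refine (norm_iteratedDeriv_bandCutoff_smul_le hF r R (abs_pos.1 hs0)).trans ?_
    rcases le_total |s| 1 with h1 | h1
    · rw [indicator_of_mem (show s ∈ Icc (-1 : ℝ) 1 from abs_le.1 h1)]
      refine le_add_of_le_of_nonneg ?_ hi2
      rw [hE, Finset.sum_mul]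
      refine Finset.sum_le_sum fun i hi => ?_
      have hik : i ≤ k := by simpa [Nat.lt_succ_iff] using hi
      have hms : 1 ≤ m |s| := hm1 _ ⟨hs0, h1⟩
      have hmm : m |s| ≤ m r := hm ⟨hr, hr1⟩ ⟨hs0, h1⟩ hout.1
      have := hB0 i
      -- The |s|^{-i} lost on the cutoff is cancelled by the weight |s|^{k-(k-i)} = |s|^i of the
      -- hypothesis.
      calc (k.choose i : ℝ) * |iteratedDeriv i (bandCutoff r R) s| * ‖iteratedDeriv (k - i) F s‖
          ≤ k.choose i * (B i / |s| ^ i) * (C * |s| ^ (k - (k - i)) * m |s| ^ (k + 1)) := by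
            gcongr
            · exact hbd i
            · exact hlow s hs0 h1 _ (Nat.sub_le _ _)
        _ = k.choose i * B i * C * m |s| ^ (k + 1) := by
            rw [Nat.sub_sub_self hik]
            field_simp
        _ ≤ _ := by gcongr
    · rw [indicator_of_mem (show s ∈ Icc (-R) R from abs_le.1 hout.2)]
      refine le_add_of_nonneg_of_le hi1 ?_
      rw [hE, Finset.sum_mul]
      refine Finset.sum_le_sum fun i hi => ?_
      have hms : 1 ≤ M |s| := hM1 _ h1
      have hmm : M |s| ≤ M R := hM h1 hR1 hout.2
      have := hB0 i
      have hbd' : |iteratedDeriv i (bandCutoff r R) s| ≤ B i :=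
        (hbd i).trans (div_le_self (hB0 i).le (one_le_pow₀ h1))
      calc (k.choose i : ℝ) * |iteratedDeriv i (bandCutoff r R) s| * ‖iteratedDeriv (k - i) F s‖
          ≤ k.choose i * B i * (C * M |s| ^ (k - i + 1)) := by
            gcongr
            exact hhigh s h1 _ (Nat.sub_le _ _)
        _ ≤ k.choose i * B i * (C * M R ^ (k + 1)) := by
            gcongr
            calc M |s| ^ (k - i + 1) ≤ M |s| ^ (k + 1) :=
                  pow_le_pow_right₀ hms (by omega)
              _ ≤ _ := by gcongr
        _ = _ := by ring
  have hint1 : Integrable ((Icc (-1 : ℝ) 1).indicator fun _ => E * m r ^ (k + 1)) :=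
    (integrable_indicator_iff measurableSet_Icc).2 (integrableOn_const (by simp))
  have hint2 : Integrable ((Icc (-R) R).indicator fun _ => E * M R ^ (k + 1)) :=
    (integrable_indicator_iff measurableSet_Icc).2 (integrableOn_const (by simp))
  have hGcont : ContDiff ℝ k G := contDiff_bandCutoff_smul (n := k) hF hr hR0
  have heq : ∫ s : ℝ, (Complex.exp (Complex.I * s * t) * (bandCutoff r R s : ℝ)) • F s =
      ∫ s : ℝ, Complex.exp (Complex.I * s * t) • G s := by
    congr 1 with s
    rw [mul_smul, hG, Complex.coe_smul]
  rw [heq]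
  refine (norm_integral_exp_smul_le hGcont
    (hasCompactSupport_bandCutoff_smul F hr hrR) ht).trans ?_
  gcongr
  have hbound : ∫ s, ‖iteratedDeriv k G s‖ ≤
      ∫ s, ((Icc (-1 : ℝ) 1).indicator (fun _ => E * m r ^ (k + 1)) s +
        (Icc (-R) R).indicator (fun _ => E * M R ^ (k + 1)) s) :=
    integral_mono_of_nonneg (ae_of_all _ fun _ => norm_nonneg _) (hint1.add hint2)
      (ae_of_all _ hpt)
  refine hbound.trans_eq ?_
  rw [integral_add hint1 hint2, integral_indicator measurableSet_Icc,
    integral_indicator measurableSet_Icc, setIntegral_const, setIntegral_const,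
    Real.volume_real_Icc_of_le (by norm_num), Real.volume_real_Icc_of_le (by linarith)]
  simp only [smul_eq_mul]
  ring

/-- Polynomial-type decay rates for a function which is small up to oscillatory integrals. -/
theorem isBigO_of_contDiffOn {f F : ℝ → X} {A : ℝ}
    (hA : ∀ r > 0, ∀ R > 0, ∀ t ≥ 1, ‖f t‖ ≤ A * (r + 1 / R) +
      ‖∫ s : ℝ, (Complex.exp (Complex.I * s * t) * (bandCutoff r R s : ℝ)) • F s‖)
    {m M : ℝ → ℝ} (hmc : ContinuousOn m (Ioc 0 1)) (hm : AntitoneOn m (Ioc 0 1))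
    (hm1 : ∀ r ∈ Ioc (0 : ℝ) 1, 1 ≤ m r) (hMc : ContinuousOn M (Ici 1))
    (hM : MonotoneOn M (Ici 1)) (hM1 : ∀ R ∈ Ici (1 : ℝ), 1 ≤ M R) {k : ℕ} (hk : 1 ≤ k)
    (hF : ContDiffOn ℝ k F {0}ᶜ) {C : ℝ} (hC : 0 < C)
    (hlow : ∀ s : ℝ, 0 < |s| → |s| ≤ 1 → ∀ j : ℕ, j ≤ k →
      ‖iteratedDeriv j F s‖ ≤ C * |s| ^ (k - j) * m |s| ^ (k + 1))
    (hhigh : ∀ s : ℝ, 1 ≤ |s| → ∀ j : ℕ, j ≤ k →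
      ‖iteratedDeriv j F s‖ ≤ C * M |s| ^ (j + 1)) {c : ℝ} (hc : 0 < c) :
    (fun t : ℝ => ‖f t‖) =O[atTop] fun t : ℝ =>
      lowerInv (lowerK m k) (c * t) + 1 / upperInv (upperK M k) (c * t) := by
  obtain ⟨D, hD0, hD⟩ := exists_norm_integral_bandCutoff_le_of_contDiffOn hF hm hm1 hM hM1 hC
    hlow hhigh
  refine IsBigO.of_bound (A + D * c ^ k) ?_
  -- The threshold 2 for R, with r ≤ 1, ensures 2r ≤ R.
  filter_upwards [eventually_ge_atTop 1,
    eventually_lowerInv (continuousOn_lowerK (k := k) hmc) (lowerK_strictAntiOn hm hm1 hk)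
      (exists_le_lowerK hm1 hk) hc one_pos,
    eventually_upperInv (continuousOn_upperK (k := k) hMc) (upperK_strictMonoOn hM hM1 hk)
      (exists_le_upperK hM1 hk) hc 2] with t ht hr hR
  obtain ⟨⟨hr0, hr1⟩, -, hrt⟩ := hr
  obtain ⟨hR1, hR2, hRt⟩ := hR
  set r := lowerInv (lowerK m k) (c * t)
  set R := upperInv (upperK M k) (c * t)
  have hR0 : 0 < R := by linarith
  have ht0 : 0 < t := by linarith
  have h1 := pow_succ_eq_of_lowerK_eq hk hr0 (by linarith [hm1 r ⟨hr0, hr1⟩]) hrt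
  have h2 := pow_succ_eq_of_upperK_eq hk (by linarith [hM1 R hR1]) hRt
  -- The square in `M_k` absorbs two factors R: one from the length of the interval, one to leave
  -- 1/R.
  have h3 : R * M R ^ (k + 1) ≤ (c * t) ^ k * (1 / R) := by
    rw [← h2, mul_one_div, le_div_iff₀ hR0]
    have : 0 ≤ M R ^ (k + 1) := pow_nonneg (by linarith [hM1 R hR1]) _
    nlinarith
  have h4 := hD r R t hr0 hr1 (by linarith) hR1 ht0
  have h5 : D * (m r ^ (k + 1) + R * M R ^ (k + 1)) / t ^ k ≤ D * c ^ k * (r + 1 / R) := by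
    rw [div_le_iff₀ (by positivity)]
    calc _ ≤ D * ((c * t) ^ k * r + (c * t) ^ k * (1 / R)) := by rw [h1]; gcongr
      _ = _ := by rw [mul_pow]; ring
  have hpos : 0 ≤ r + 1 / R := by positivity
  rw [norm_norm, Real.norm_of_nonneg hpos, add_mul]
  exact (hA r hr0 R hR0 t ht).trans (add_le_add le_rfl (h4.trans h5))

/-! ### Factorial estimates -/

section Factorials

/-- From j = 2 on, consecutive terms have ratio at most kq ≤ 1, so each is at most 6q²; fewer than k
of them sum to at most 6, and the first two terms give at most 1 + 2. -/
theorem sum_factorial_succ_mul_pow_le {q : ℝ} (hq : 0 ≤ q) {k : ℕ} (hk : k * q ≤ 1) :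
    ∑ j ∈ Finset.range k, ((j + 1).factorial : ℝ) * q ^ j ≤ 9 := by
  have hterm : ∀ n : ℕ, n + 3 ≤ k → ((n + 3).factorial : ℝ) * q ^ (n + 2) ≤ 6 * q ^ 2 := by
    intro n
    induction n with
    | zero => intro _; norm_num [Nat.factorial]
    | succ n ih =>
      intro hn
      have h1 : ((n + 4 : ℕ) : ℝ) * q ≤ 1 :=
        (mul_le_mul_of_nonneg_right (by exact_mod_cast hn) hq).trans hk
      calc ((n + 1 + 3).factorial : ℝ) * q ^ (n + 1 + 2)
          = (((n + 4 : ℕ) : ℝ) * q) * (((n + 3).factorial : ℝ) * q ^ (n + 2)) := by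
            rw [show n + 1 + 3 = (n + 3) + 1 by ring, Nat.factorial_succ]
            push_cast
            ring
        _ ≤ 1 * (6 * q ^ 2) := mul_le_mul h1 (ih (by omega)) (by positivity) zero_le_one
        _ = _ := one_mul _
  have hsum : ∀ n : ℕ, n + 2 ≤ k →
      ∑ j ∈ Finset.range (n + 2), ((j + 1).factorial : ℝ) * q ^ j ≤ 1 + 2 * q + n * (6 * q ^ 2) := by
    intro n
    induction n with
    | zero => intro _; norm_num [Finset.sum_range_succ, Nat.factorial]
    | succ n ih =>
      intro hn
      rw [show n + 1 + 2 = (n + 2) + 1 by ring, Finset.sum_range_succ]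
      have := ih (by omega)
      have := hterm n (by omega)
      push_cast
      linarith
  match k with
  | 0 => simp
  | 1 => simp
  | n + 2 =>
    have h1 := hsum n le_rfl
    push_cast at hk
    have hn : (0 : ℝ) ≤ n := by positivity
    have hq1 : q ≤ 1 := by nlinarith
    have h2 : n * (6 * q ^ 2) ≤ 6 := by nlinarith
    linarith

theorem sum_factorial_mul_pow_le {q : ℝ} (hq : 0 ≤ q) {k : ℕ} (hk : k * q ≤ 1) :
    ∑ j ∈ Finset.range k, (j.factorial : ℝ) * q ^ j ≤ 9 := by
  refine le_trans (Finset.sum_le_sum fun j _ => ?_) (sum_factorial_succ_mul_pow_le hq hk)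
  gcongr
  omega

/-- A weak Stirling bound, by induction from (k/(k+1))^{k+1} ≤ e^{-1}. -/
theorem factorial_le_pow_mul_exp {k : ℕ} (hk : 1 ≤ k) :
    (k.factorial : ℝ) ≤ (k : ℝ) ^ (k + 1) * Real.exp (1 - k) := by
  induction k, hk using Nat.le_induction with
  | base => simp
  | succ k hk ih =>
    have hk0 : (0 : ℝ) < k := by exact_mod_cast hk
    have h1 : (k : ℝ) ^ (k + 1) ≤ ((k : ℝ) + 1) ^ (k + 1) * Real.exp (-1) := by
      have h2 : (k : ℝ) ≤ (k + 1) * Real.exp (-1 / (k + 1)) := by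
        have := Real.add_one_le_exp (-1 / ((k : ℝ) + 1))
        calc (k : ℝ) = (k + 1) * (-1 / (k + 1) + 1) := by field_simp; ring
          _ ≤ _ := by gcongr
      calc (k : ℝ) ^ (k + 1) ≤ ((k + 1) * Real.exp (-1 / (k + 1))) ^ (k + 1) := by gcongr
        _ = _ := by
          rw [mul_pow, ← Real.exp_nat_mul]
          congr 2
          push_cast
          field_simp
    calc ((k + 1).factorial : ℝ) = (k + 1) * k.factorial := by
          rw [Nat.factorial_succ]; push_cast; ring
      _ ≤ (k + 1) * (((k : ℝ) + 1) ^ (k + 1) * Real.exp (-1) * Real.exp (1 - k)) := by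
          gcongr
          exact ih.trans (by gcongr)
      _ = _ := by
          rw [mul_assoc (_ ^ _), ← Real.exp_add]
          push_cast
          rw [show (-1 : ℝ) + (1 - k) = 1 - (k + 1) by ring]
          ring

/-- k!/T^k is smallest for k near T. Rounding down costs a factor e, because T < k + 1; the other e
comes from the Stirling bound. -/
theorem factorial_floor_div_pow_le {T : ℝ} (hT : 1 ≤ T) :
    (⌊T⌋₊.factorial : ℝ) / T ^ ⌊T⌋₊ ≤ Real.exp 2 * (T * Real.exp (-T)) := by
  set k := ⌊T⌋₊ with hk
  have hk1 : 1 ≤ k := Nat.one_le_floor_iff T |>.2 hT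
  have hkT : (k : ℝ) ≤ T := Nat.floor_le (by linarith)
  have hTk : T < k + 1 := Nat.lt_floor_add_one T
  rw [div_le_iff₀ (by positivity)]
  calc (k.factorial : ℝ) ≤ (k : ℝ) ^ (k + 1) * Real.exp (1 - k) := factorial_le_pow_mul_exp hk1
    _ ≤ T ^ (k + 1) * Real.exp (2 - T) := by
        refine mul_le_mul (pow_le_pow_left₀ (by positivity) hkT _)
          (Real.exp_le_exp.2 (by linarith)) (by positivity) (by positivity)
    _ = _ := by rw [sub_eq_add_neg, Real.exp_add]; ring

theorem mul_exp_neg_mul_le {δ : ℝ} (hδ : 0 < δ) (T : ℝ) : T * Real.exp (-(δ * T)) ≤ 1 / δ := by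
  rw [Real.exp_neg, ← div_eq_mul_inv, div_le_div_iff₀ (Real.exp_pos _) hδ, one_mul, mul_comm]
  linarith [Real.add_one_le_exp (δ * T)]

end Factorials

/-! ### Repeated integration by parts on an interval -/

section IntegrationByParts

/-- The sum produced by repeated integration by parts; `G j` is the `j`-th derivative of `G 0`. -/
def ibpSum (G : ℕ → ℝ → X) (w : ℂ) (k : ℕ) (s : ℝ) : X :=
  ∑ j ∈ Finset.range k, w ^ (j + 1) • G j s

/-- The sum produced by repeated integration by parts applied to `ibpSum`. -/
def ibpSumTwo (G : ℕ → ℝ → X) (w : ℂ) (k : ℕ) (s : ℝ) : X :=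
  ∑ j ∈ Finset.range k, (((j : ℂ) + 1) * w ^ (j + 2)) • G j s

variable {G : ℕ → ℝ → X} {s t : ℝ}

theorem I_mul_mul_I_div (ht : t ≠ 0) : Complex.I * t * (Complex.I / t) = -1 := by
  have : (t : ℂ) ≠ 0 := by exact_mod_cast ht
  field_simp
  exact Complex.I_sq

theorem hasDerivAt_exp_I_mul (s t : ℝ) : HasDerivAt (fun s : ℝ => Complex.exp (Complex.I * s * t))
    (Complex.exp (Complex.I * s * t) * (Complex.I * t)) s := by
  have h1 : HasDerivAt (fun s : ℝ => Complex.I * s * t) (Complex.I * t) s := by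
    have := ((Complex.ofRealCLM.hasDerivAt (x := s)).const_mul Complex.I).mul_const (t : ℂ)
    simpa using this
  exact h1.cexp

/-- With w = i/t one has it · w = -1, so the two sums from the product rule telescope. Up to the
term w^k G_k, minus this function is a primitive of e^{ist} G_0. -/
theorem hasDerivAt_exp_smul_ibpSum (ht : t ≠ 0) (hG : ∀ j, HasDerivAt (G j) (G (j + 1) s) s)
    (k : ℕ) :
    HasDerivAt (fun s : ℝ => Complex.exp (Complex.I * s * t) • ibpSum G (Complex.I / t) k s)
      (Complex.exp (Complex.I * s * t) • ((Complex.I / t) ^ k • G k s - G 0 s)) s := by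
  set w : ℂ := Complex.I / t with hw
  have hP : HasDerivAt (ibpSum G w k) (∑ j ∈ Finset.range k, w ^ (j + 1) • G (j + 1) s) s :=
    HasDerivAt.fun_sum fun j _ => (hG j).const_smul _
  convert! (hasDerivAt_exp_I_mul s t).smul hP using 1
  rw [mul_smul (Complex.exp _), ← smul_add]
  congr 1
  have h1 : ∑ j ∈ Finset.range k, w ^ (j + 1) • G (j + 1) s =
      ∑ j ∈ Finset.range (k + 1), w ^ j • G j s - G 0 s := by
    rw [Finset.sum_range_succ']
    simp
  have h2 : (Complex.I * t) • ibpSum G w k s = -∑ j ∈ Finset.range k, w ^ j • G j s := by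
    rw [ibpSum, Finset.smul_sum, ← Finset.sum_neg_distrib]
    refine Finset.sum_congr rfl fun j _ => ?_
    rw [smul_smul, pow_succ', ← mul_assoc, I_mul_mul_I_div ht, neg_one_mul, neg_smul]
  rw [h1, h2, Finset.sum_range_succ]
  abel

/-- The same telescoping one level up: the weights j + 1 count the ways in which two successive
integrations by parts reach G_j, and the consecutive weights differ by 1, which leaves `ibpSum`. -/
theorem hasDerivAt_exp_smul_ibpSumTwo (ht : t ≠ 0) (hG : ∀ j, HasDerivAt (G j) (G (j + 1) s) s)
    (k : ℕ) :
    HasDerivAt (fun s : ℝ => Complex.exp (Complex.I * s * t) • ibpSumTwo G (Complex.I / t) k s)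
      (Complex.exp (Complex.I * s * t) •
        (((k : ℂ) * (Complex.I / t) ^ (k + 1)) • G k s - ibpSum G (Complex.I / t) k s)) s := by
  set w : ℂ := Complex.I / t with hw
  have hP : HasDerivAt (ibpSumTwo G w k)
      (∑ j ∈ Finset.range k, (((j : ℂ) + 1) * w ^ (j + 2)) • G (j + 1) s) s :=
    HasDerivAt.fun_sum fun j _ => (hG j).const_smul _
  convert! (hasDerivAt_exp_I_mul s t).smul hP using 1
  rw [mul_smul (Complex.exp _), ← smul_add]
  congr 1
  have h1 : ∑ j ∈ Finset.range k, (((j : ℂ) + 1) * w ^ (j + 2)) • G (j + 1) s =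
      ∑ j ∈ Finset.range (k + 1), ((j : ℂ) * w ^ (j + 1)) • G j s := by
    rw [Finset.sum_range_succ']
    simp
  have h2 : (Complex.I * t) • ibpSumTwo G w k s =
      -∑ j ∈ Finset.range k, ((j : ℂ) * w ^ (j + 1)) • G j s - ibpSum G w k s := by
    rw [ibpSumTwo, ibpSum, Finset.smul_sum, ← Finset.sum_neg_distrib, ← Finset.sum_sub_distrib]
    refine Finset.sum_congr rfl fun j _ => ?_
    rw [smul_smul, ← neg_smul, ← sub_smul]
    congr 1
    linear_combination ((j : ℂ) + 1) * w ^ (j + 1) * I_mul_mul_I_div ht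
  rw [h1, h2, Finset.sum_range_succ]
  abel

theorem norm_I_div (ht : 0 < t) : ‖Complex.I / (t : ℂ)‖ = 1 / t := by
  rw [norm_div, Complex.norm_I, Complex.norm_real, Real.norm_of_nonneg ht.le]

theorem norm_exp_I_mul_mul (s t : ℝ) : ‖Complex.exp (Complex.I * s * t)‖ = 1 := by
  rw [Complex.norm_exp]
  simp

theorem norm_ibpSum_le {W N : ℝ} {k : ℕ} (ht : 0 < t) (hW : 0 ≤ W) (hN : 0 ≤ N)
    (hk : k * N ≤ t) (hG : ∀ j, ‖G j s‖ ≤ W * (j.factorial * N ^ (j + 1))) :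
    ‖ibpSum G (Complex.I / t) k s‖ ≤ 9 * W * (N / t) := by
  have hq : k * (N / t) ≤ 1 := by rwa [← mul_div_assoc, div_le_one ht]
  calc _ ≤ ∑ j ∈ Finset.range k, W * (N / t) * (j.factorial * (N / t) ^ j) := by
        refine norm_sum_le_of_le _ fun j _ => ?_
        rw [norm_smul, norm_pow, norm_I_div ht]
        calc (1 / t) ^ (j + 1) * ‖G j s‖
            ≤ (1 / t) ^ (j + 1) * (W * (j.factorial * N ^ (j + 1))) := by gcongr; exact hG j
          _ = _ := by rw [div_pow, div_pow]; field_simp; ring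
    _ ≤ W * (N / t) * 9 := by
        rw [← Finset.mul_sum]
        gcongr
        exact sum_factorial_mul_pow_le (by positivity) hq
    _ = _ := by ring

theorem norm_ibpSumTwo_le {W N : ℝ} {k : ℕ} (ht : 0 < t) (hW : 0 ≤ W) (hN : 0 ≤ N)
    (hk : k * N ≤ t) (hG : ∀ j, ‖G j s‖ ≤ W * (j.factorial * N ^ (j + 1))) :
    ‖ibpSumTwo G (Complex.I / t) k s‖ ≤ 9 * W * (N / t) / t := by
  have hq : k * (N / t) ≤ 1 := by rwa [← mul_div_assoc, div_le_one ht]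
  calc _ ≤ ∑ j ∈ Finset.range k, W * (N / t) / t * ((j + 1).factorial * (N / t) ^ j) := by
        refine norm_sum_le_of_le _ fun j _ => ?_
        have h1 : ‖(j : ℂ) + 1‖ = j + 1 := by
          have : ((j : ℂ) + 1) = ((j + 1 : ℝ) : ℂ) := by push_cast; rfl
          rw [this, Complex.norm_real, Real.norm_of_nonneg (by positivity)]
        rw [norm_smul, norm_mul, norm_pow, norm_I_div ht, h1]
        calc ((j : ℝ) + 1) * (1 / t) ^ (j + 2) * ‖G j s‖
            ≤ (j + 1) * (1 / t) ^ (j + 2) * (W * (j.factorial * N ^ (j + 1))) := by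
              gcongr; exact hG j
          _ = _ := by rw [Nat.factorial_succ, div_pow, div_pow]; push_cast; field_simp; ring
    _ ≤ W * (N / t) / t * 9 := by
        rw [← Finset.mul_sum]
        gcongr
        exact sum_factorial_succ_mul_pow_le (by positivity) hq
    _ = _ := by ring

variable {a b : ℝ} {η η' : ℝ → ℝ}

theorem continuousOn_of_derivs (hG : ∀ s ∈ Icc a b, ∀ j, HasDerivAt (G j) (G (j + 1) s) s) (j : ℕ) :
    ContinuousOn (G j) (Icc a b) := fun s hs => (hG s hs j).continuousAt.continuousWithinAt

theorem continuousOn_ibpSum (hG : ∀ s ∈ Icc a b, ∀ j, HasDerivAt (G j) (G (j + 1) s) s)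
    (w : ℂ) (k : ℕ) : ContinuousOn (ibpSum G w k) (Icc a b) :=
  continuousOn_finsetSum _ fun j _ => (continuousOn_of_derivs hG j).const_smul _

theorem continuousOn_ibpSumTwo (hG : ∀ s ∈ Icc a b, ∀ j, HasDerivAt (G j) (G (j + 1) s) s)
    (w : ℂ) (k : ℕ) : ContinuousOn (ibpSumTwo G w k) (Icc a b) :=
  continuousOn_finsetSum _ fun j _ => (continuousOn_of_derivs hG j).const_smul _

/-- The weight η is differentiated only once however large k is, so k may grow with t although η is
merely smooth. -/
theorem integral_smul_exp_smul_eq [CompleteSpace X] (hab : a ≤ b) (ht : t ≠ 0)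
    (hG : ∀ s ∈ Icc a b, ∀ j, HasDerivAt (G j) (G (j + 1) s) s)
    (hη : ∀ s, HasDerivAt η (η' s) s) (hη' : Continuous η') (k : ℕ) :
    ∫ s in a..b, η s • (Complex.exp (Complex.I * s * t) • G 0 s) =
      (∫ s in a..b, η' s • (Complex.exp (Complex.I * s * t) • ibpSum G (Complex.I / t) k s)) +
      (∫ s in a..b, η s • (Complex.exp (Complex.I * s * t) • ((Complex.I / t) ^ k • G k s))) -
      (η b • (Complex.exp (Complex.I * b * t) • ibpSum G (Complex.I / t) k b) -
        η a • (Complex.exp (Complex.I * a * t) • ibpSum G (Complex.I / t) k a)) := by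
  have hηc : Continuous η := continuous_iff_continuousAt.2 fun s => (hη s).continuousAt
  have hec : Continuous fun s : ℝ => Complex.exp (Complex.I * s * t) := by fun_prop
  have hint : ∀ {u : ℝ → ℝ} {v : ℝ → X}, Continuous u → ContinuousOn v (Icc a b) →
      IntervalIntegrable (fun s : ℝ => u s • (Complex.exp (Complex.I * s * t) • v s)) volume a b := by
    intro u v hu hv
    refine ContinuousOn.intervalIntegrable ?_
    rw [uIcc_of_le hab]
    exact hu.continuousOn.smul (hec.continuousOn.smul hv)
  have h1 := hint hη' (continuousOn_ibpSum hG (Complex.I / t) k)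
  have h2 := hint (v := fun s => (Complex.I / (t : ℂ)) ^ k • G k s) hηc
    ((continuousOn_of_derivs hG k).const_smul _)
  have h3 := hint hηc (continuousOn_of_derivs hG 0)
  have h4 := intervalIntegral.integral_eq_sub_of_hasDerivAt (a := a) (b := b)
    (f := fun s : ℝ => η s • (Complex.exp (Complex.I * s * t) • ibpSum G (Complex.I / t) k s))
    (f' := fun s : ℝ => η' s • (Complex.exp (Complex.I * s * t) • ibpSum G (Complex.I / t) k s) +
      (η s • (Complex.exp (Complex.I * s * t) • ((Complex.I / t) ^ k • G k s)) -
        η s • (Complex.exp (Complex.I * s * t) • G 0 s)))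
    (fun s hs => by
      rw [uIcc_of_le hab] at hs
      convert! (hη s).smul (hasDerivAt_exp_smul_ibpSum ht (hG s hs) k) using 1
      rw [smul_sub, smul_sub, add_comm])
    (h1.add (h2.sub h3))
  rw [intervalIntegral.integral_add h1 (h2.sub h3), intervalIntegral.integral_sub h2 h3] at h4
  rw [← h4]
  abel

/-- Applied with the derivative of the cutoff as weight, it moves a second derivative onto the
cutoff and gains another factor 1/R at high frequencies. -/
theorem integral_smul_exp_smul_ibpSum_eq [CompleteSpace X] (hab : a ≤ b) (ht : t ≠ 0)
    (hG : ∀ s ∈ Icc a b, ∀ j, HasDerivAt (G j) (G (j + 1) s) s)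
    (hη : ∀ s, HasDerivAt η (η' s) s) (hη' : Continuous η') (k : ℕ) :
    ∫ s in a..b, η s • (Complex.exp (Complex.I * s * t) • ibpSum G (Complex.I / t) k s) =
      (∫ s in a..b, η' s • (Complex.exp (Complex.I * s * t) • ibpSumTwo G (Complex.I / t) k s)) +
      (∫ s in a..b, η s • (Complex.exp (Complex.I * s * t) •
        (((k : ℂ) * (Complex.I / t) ^ (k + 1)) • G k s))) -
      (η b • (Complex.exp (Complex.I * b * t) • ibpSumTwo G (Complex.I / t) k b) -
        η a • (Complex.exp (Complex.I * a * t) • ibpSumTwo G (Complex.I / t) k a)) := by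
  have hηc : Continuous η := continuous_iff_continuousAt.2 fun s => (hη s).continuousAt
  have hec : Continuous fun s : ℝ => Complex.exp (Complex.I * s * t) := by fun_prop
  have hint : ∀ {u : ℝ → ℝ} {v : ℝ → X}, Continuous u → ContinuousOn v (Icc a b) →
      IntervalIntegrable (fun s : ℝ => u s • (Complex.exp (Complex.I * s * t) • v s)) volume a b := by
    intro u v hu hv
    refine ContinuousOn.intervalIntegrable ?_
    rw [uIcc_of_le hab]
    exact hu.continuousOn.smul (hec.continuousOn.smul hv)
  have h1 := hint hη' (continuousOn_ibpSumTwo hG (Complex.I / t) k)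
  have h2 := hint (v := fun s => ((k : ℂ) * (Complex.I / (t : ℂ)) ^ (k + 1)) • G k s) hηc
    ((continuousOn_of_derivs hG k).const_smul _)
  have h3 := hint hηc (continuousOn_ibpSum hG (Complex.I / t) k)
  have h4 := intervalIntegral.integral_eq_sub_of_hasDerivAt (a := a) (b := b)
    (f := fun s : ℝ => η s • (Complex.exp (Complex.I * s * t) • ibpSumTwo G (Complex.I / t) k s))
    (f' := fun s : ℝ =>
      η' s • (Complex.exp (Complex.I * s * t) • ibpSumTwo G (Complex.I / t) k s) +
      (η s • (Complex.exp (Complex.I * s * t) •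
          (((k : ℂ) * (Complex.I / t) ^ (k + 1)) • G k s)) -
        η s • (Complex.exp (Complex.I * s * t) • ibpSum G (Complex.I / t) k s)))
    (fun s hs => by
      rw [uIcc_of_le hab] at hs
      convert! (hη s).smul (hasDerivAt_exp_smul_ibpSumTwo ht (hG s hs) k) using 1
      rw [smul_sub, smul_sub, add_comm])
    (h1.add (h2.sub h3))
  rw [intervalIntegral.integral_add h1 (h2.sub h3), intervalIntegral.integral_sub h2 h3] at h4
  rw [← h4]
  abel

theorem norm_smul_exp_smul (x s t : ℝ) (v : X) :
    ‖x • (Complex.exp (Complex.I * s * t) • v)‖ = |x| * ‖v‖ := by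
  rw [norm_smul, norm_smul, norm_exp_I_mul_mul, one_mul, Real.norm_eq_abs]

theorem norm_integral_smul_exp_smul_le {u : ℝ → ℝ} {v : ℝ → X} {D : ℝ} (hab : a ≤ b)
    (h : ∀ s ∈ Icc a b, |u s| * ‖v s‖ ≤ D) :
    ‖∫ s in a..b, u s • (Complex.exp (Complex.I * s * t) • v s)‖ ≤ D * (b - a) := by
  rw [← abs_of_nonneg (sub_nonneg.2 hab)]
  refine intervalIntegral.norm_integral_le_of_norm_le_const fun s hs => ?_
  rw [uIoc_of_le hab] at hs
  rw [norm_smul_exp_smul]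
  exact h s ⟨hs.1.le, hs.2⟩

end IntegrationByParts

/-! ### Analytic-type bounds: case (b) -/

theorem abs_bandCutoff_le (r R s : ℝ) : |bandCutoff r R s| ≤ 1 := by
  rw [bandCutoff, abs_le]
  have h1 := cutoff.nonneg' (2 / R * s)
  have h2 := cutoff.le_one (x := 2 / R * s)
  have h3 := cutoff.nonneg' (r⁻¹ * s)
  have h4 := cutoff.le_one (x := r⁻¹ * s)
  constructor <;> linarith

theorem iteratedDeriv_cutoff_eq_zero {l : ℕ} (hl : l ≠ 0) {x : ℝ} (hx : |x| < 1 ∨ 2 < |x|) :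
    iteratedDeriv l cutoff x = 0 := by
  have hconst : ∃ y : ℝ, cutoff =ᶠ[𝓝 x] fun _ => y := by
    rcases hx with hx | hx
    · refine ⟨1, ?_⟩
      filter_upwards [continuous_abs.continuousAt.eventually_lt_const hx] with z hz
      exact cutoff_eq_one hz.le
    · refine ⟨0, ?_⟩
      filter_upwards [continuous_abs.continuousAt.eventually_const_lt hx] with z hz
      exact cutoff_eq_zero hz.le
  obtain ⟨y, hy⟩ := hconst
  rw [hy.iteratedDeriv_eq]
  simp [iteratedDeriv_const, hl]

/-- For |s| ≤ 1 the outer cutoff sits inside its plateau, since |2s/R| ≤ 1/2; only the inner one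
contributes. -/
theorem iteratedDeriv_bandCutoff_of_low {l : ℕ} (hl : l ≠ 0) {r R s : ℝ} (hR : 4 ≤ R)
    (hs : |s| ≤ 1) :
    iteratedDeriv l (bandCutoff r R) s = -(r⁻¹ ^ l * iteratedDeriv l cutoff (r⁻¹ * s)) := by
  have h : |2 / R * s| < 1 := by
    rw [abs_mul, abs_of_pos (by positivity), div_mul_eq_mul_div, div_lt_one (by linarith)]
    linarith
  rw [iteratedDeriv_bandCutoff, iteratedDeriv_cutoff_eq_zero hl (Or.inl h), mul_zero, zero_sub]

theorem iteratedDeriv_bandCutoff_of_high {l : ℕ} (hl : l ≠ 0) {r R s : ℝ} (hr : 0 < r)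
    (hr4 : r ≤ 1 / 4) (hs : 1 ≤ |s|) :
    iteratedDeriv l (bandCutoff r R) s = (2 / R) ^ l * iteratedDeriv l cutoff (2 / R * s) := by
  have h : 2 < |r⁻¹ * s| := by
    rw [abs_mul, abs_of_pos (inv_pos.2 hr), ← div_eq_inv_mul, lt_div_iff₀ hr]
    linarith
  rw [iteratedDeriv_bandCutoff, iteratedDeriv_cutoff_eq_zero hl (Or.inr h), mul_zero, sub_zero]

theorem hasDerivAt_iteratedDeriv_bandCutoff (r R : ℝ) (l : ℕ) (s : ℝ) :
    HasDerivAt (iteratedDeriv l (bandCutoff r R)) (iteratedDeriv (l + 1) (bandCutoff r R) s) s := by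
  rw [iteratedDeriv_succ]
  exact ((contDiff_bandCutoff r R (n := (l + 1 : ℕ))).differentiable_iteratedDeriv l
    (by exact_mod_cast Nat.lt_succ_self l) s).hasDerivAt

theorem continuous_iteratedDeriv_bandCutoff (r R : ℝ) (l : ℕ) :
    Continuous (iteratedDeriv l (bandCutoff r R)) :=
  continuous_iff_continuousAt.2 fun s => (hasDerivAt_iteratedDeriv_bandCutoff r R l s).continuousAt

theorem hasDerivAt_bandCutoff (r R s : ℝ) :
    HasDerivAt (bandCutoff r R) (iteratedDeriv 1 (bandCutoff r R) s) s := by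
  simpa using hasDerivAt_iteratedDeriv_bandCutoff r R 0 s

theorem integrable_abs_mul_iteratedDeriv_cutoff :
    Integrable fun x : ℝ => |x| * |iteratedDeriv 1 cutoff x| := by
  have h := SchwartzMap.integrable_pow_mul_iteratedFDeriv volume
    (cutoff.hasCompactSupport.toSchwartzMap contDiff_cutoff) 1 1
  refine h.congr (ae_of_all _ fun x => ?_)
  simp only [pow_one, norm_iteratedFDeriv_eq_norm_iteratedDeriv, Real.norm_eq_abs]
  rfl

theorem hasDerivAt_iteratedDeriv_of_contDiffOn {F : ℝ → X} (hF : ContDiffOn ℝ ∞ F {0}ᶜ) {s : ℝ}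
    (hs : s ≠ 0) (j : ℕ) : HasDerivAt (iteratedDeriv j F) (iteratedDeriv (j + 1) F s) s := by
  have hopen : IsOpen ({0}ᶜ : Set ℝ) := isOpen_compl_singleton
  have hmem : ({0}ᶜ : Set ℝ) ∈ 𝓝 s := hopen.mem_nhds hs
  have h1 := hF.differentiableOn_iteratedDerivWithin (m := j) (by exact_mod_cast ENat.natCast_lt_top j)
    hopen.uniqueDiffOn
  have h2 : DifferentiableAt ℝ (iteratedDeriv j F) s :=
    (h1.differentiableAt hmem).congr_of_eventuallyEq
      (((iteratedDerivWithin_of_isOpen (n := j) (f := F) hopen).symm).eventuallyEq_of_mem hmem)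
  rw [iteratedDeriv_succ]
  exact h2.hasDerivAt

/-- The size of the remainder after the near-optimal number ⌊t/N⌋ of integrations by parts. -/
theorem inv_pow_mul_factorial_mul_pow_le {N t C : ℝ} (hC : 0 ≤ C) (hN : 0 < N) (hNt : N ≤ t) :
    (1 / t) ^ ⌊t / N⌋₊ * (C * (⌊t / N⌋₊.factorial * N ^ (⌊t / N⌋₊ + 1))) ≤
      C * Real.exp 2 * (N * (t / N * Real.exp (-(t / N)))) := by
  have ht : 0 < t := hN.trans_le hNt
  have h := factorial_floor_div_pow_le ((one_le_div hN).2 hNt)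
  set k := ⌊t / N⌋₊
  calc _ = C * N * (k.factorial / (t / N) ^ k) := by
        rw [div_pow, div_pow]; field_simp; ring
    _ ≤ C * N * (Real.exp 2 * (t / N * Real.exp (-(t / N)))) := by gcongr
    _ = _ := by ring

theorem floor_div_mul_le {N t : ℝ} (hN : 0 < N) (ht : 0 ≤ t) : (⌊t / N⌋₊ : ℝ) * N ≤ t :=
  (le_div_iff₀ hN).1 (Nat.floor_le (by positivity))

/-- The oscillatory integral over low frequencies, in the analytic case. -/
theorem exists_norm_integral_low_le [CompleteSpace X] {F : ℝ → X} (hF : ContDiffOn ℝ ∞ F {0}ᶜ)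
    {m : ℝ → ℝ} (hm : AntitoneOn m (Ioc 0 1)) (hm1 : ∀ r ∈ Ioc (0 : ℝ) 1, 1 ≤ m r) {C : ℝ}
    (hC : 0 < C) (hlow : ∀ s : ℝ, 0 < |s| → |s| ≤ 1 → ∀ j : ℕ,
      ‖iteratedDeriv j F s‖ ≤ C * (j.factorial : ℝ) * |s| * m |s| ^ (j + 1)) :
    ∃ D : ℝ, 0 < D ∧ ∀ r R t a b : ℝ, 0 < r → r ≤ 1 / 4 → 4 ≤ R → m r ≤ t → a ≤ b → b - a ≤ 1 →
      (∀ s ∈ Icc a b, r ≤ |s| ∧ |s| ≤ 1) → (|a| = r ∨ |a| = 1) → (|b| = r ∨ |b| = 1) →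
      ‖∫ s in a..b, bandCutoff r R s • (Complex.exp (Complex.I * s * t) • F s)‖ ≤
        D * (r + 1 / t + m r * (t / m r * Real.exp (-(t / m r)))) := by
  set J := ∫ x : ℝ, |x| * |iteratedDeriv 1 cutoff x| with hJ
  have hJ0 : 0 ≤ J := integral_nonneg fun x => by positivity
  have hm11 : 1 ≤ m 1 := hm1 1 ⟨one_pos, le_rfl⟩
  -- The three summands come from the term with the derivative of the cutoff, the two endpoints, and
  -- the remainder.
  refine ⟨9 * C * J + 18 * C * m 1 + C * Real.exp 2, by positivity,
    fun r R t a b hr hr4 hR hmt hab hab1 hI ha hb => ?_⟩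
  have hr1 : r ∈ Ioc (0 : ℝ) 1 := ⟨hr, by linarith⟩
  have hmr : 1 ≤ m r := hm1 r hr1
  set N := m r with hN
  have hN0 : 0 < N := by linarith
  have ht0 : 0 < t := by linarith
  set k := ⌊t / N⌋₊ with hk
  have hkN : (k : ℝ) * N ≤ t := floor_div_mul_le hN0 ht0.le
  have hG : ∀ s ∈ Icc a b, ∀ j, HasDerivAt (iteratedDeriv j F) (iteratedDeriv (j + 1) F s) s :=
    fun s hs j => hasDerivAt_iteratedDeriv_of_contDiffOn hF
      (abs_pos.1 (hr.trans_le (hI s hs).1)) j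
  have hGb : ∀ s ∈ Icc a b, ∀ j,
      ‖iteratedDeriv j F s‖ ≤ C * |s| * (j.factorial * N ^ (j + 1)) := by
    intro s hs j
    obtain ⟨h1, h2⟩ := hI s hs
    have hs0 : 0 < |s| := hr.trans_le h1
    have h3 : m |s| ≤ N := hm hr1 ⟨hs0, h2⟩ h1
    have h4 : 1 ≤ m |s| := hm1 _ ⟨hs0, h2⟩
    calc _ ≤ C * (j.factorial : ℝ) * |s| * m |s| ^ (j + 1) := hlow s hs0 h2 j
      _ ≤ C * (j.factorial : ℝ) * |s| * N ^ (j + 1) := by gcongr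
      _ = _ := by ring
  -- The cutoff vanishes at |s| = r. At |s| = 1 the derivative bounds hold with m(1) in place of N =
  -- m(r), so the boundary term is O(1/t) uniformly in r.
  have hbdry : ∀ s, (|s| = r ∨ |s| = 1) → |bandCutoff r R s| *
      ‖ibpSum (fun j => iteratedDeriv j F) (Complex.I / t) k s‖ ≤ 9 * C * m 1 * (1 / t) := by
    rintro s (hs | hs)
    · rw [bandCutoff_eq_zero_of_le hr (by linarith) hs.le (by linarith), abs_zero, zero_mul]
      positivity
    · have h1 : ‖ibpSum (fun j => iteratedDeriv j F) (Complex.I / t) k s‖ ≤ 9 * C * (m 1 / t) := by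
        refine norm_ibpSum_le ht0 hC.le (by linarith) ?_ fun j => ?_
        · have : m 1 ≤ N := hm hr1 ⟨one_pos, le_rfl⟩ hr1.2
          exact (mul_le_mul_of_nonneg_left this (by positivity)).trans hkN
        · have := hlow s (by rw [hs]; exact one_pos) hs.le j
          rw [hs, mul_one, mul_assoc] at this
          exact this
      calc _ ≤ 1 * (9 * C * (m 1 / t)) := mul_le_mul (abs_bandCutoff_le r R s) h1
            (norm_nonneg _) zero_le_one
        _ = _ := by ring
  -- The factor |s| of the hypothesis pairs with r⁻¹|cutoff'(s/r)|; the substitution x = s/r then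
  -- yields r J.
  have hmid : ‖∫ s in a..b, iteratedDeriv 1 (bandCutoff r R) s • (Complex.exp (Complex.I * s * t) •
      ibpSum (fun j => iteratedDeriv j F) (Complex.I / t) k s)‖ ≤ 9 * C * J * r := by
    set h : ℝ → ℝ := fun x => |x| * |iteratedDeriv 1 cutoff x| with hh
    have hhi : Integrable fun s => 9 * C * h (r⁻¹ * s) :=
      ((integrable_comp_mul_left_iff h (inv_pos.2 hr).ne').2
        integrable_abs_mul_iteratedDeriv_cutoff).const_mul _
    have hpt : ∀ s ∈ Icc a b, ‖iteratedDeriv 1 (bandCutoff r R) s •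
        (Complex.exp (Complex.I * s * t) •
          ibpSum (fun j => iteratedDeriv j F) (Complex.I / t) k s)‖ ≤ 9 * C * h (r⁻¹ * s) := by
      intro s hs
      rw [norm_smul_exp_smul, iteratedDeriv_bandCutoff_of_low one_ne_zero hR (hI s hs).2, abs_neg,
        pow_one, abs_mul, abs_of_pos (inv_pos.2 hr)]
      have h1 : ‖ibpSum (fun j => iteratedDeriv j F) (Complex.I / t) k s‖ ≤
          9 * (C * |s|) * (N / t) :=
        norm_ibpSum_le ht0 (by positivity) hN0.le hkN (hGb s hs)
      have h2 : N / t ≤ 1 := (div_le_one ht0).2 hmt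
      calc r⁻¹ * |iteratedDeriv 1 cutoff (r⁻¹ * s)| *
            ‖ibpSum (fun j => iteratedDeriv j F) (Complex.I / t) k s‖
          ≤ r⁻¹ * |iteratedDeriv 1 cutoff (r⁻¹ * s)| * (9 * (C * |s|) * 1) := by
            gcongr
            exact h1.trans (by gcongr)
        _ = _ := by
            simp only [hh, abs_mul, abs_of_pos (inv_pos.2 hr)]
            ring
    refine (intervalIntegral.norm_integral_le_of_norm_le hab
      (ae_of_all _ fun s hs => hpt s ⟨hs.1.le, hs.2⟩) hhi.intervalIntegrable).trans ?_
    rw [intervalIntegral.integral_of_le hab]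
    refine (setIntegral_le_integral hhi (ae_of_all _ fun s => by
      simp only [hh, Pi.zero_apply]; positivity)).trans_eq ?_
    rw [integral_const_mul, Measure.integral_comp_mul_left h, inv_inv, abs_of_pos hr, smul_eq_mul]
    ring
  have hrem : ‖∫ s in a..b, bandCutoff r R s • (Complex.exp (Complex.I * s * t) •
      ((Complex.I / t) ^ k • iteratedDeriv k F s))‖ ≤
      C * Real.exp 2 * (N * (t / N * Real.exp (-(t / N)))) := by
    refine (norm_integral_smul_exp_smul_le
      (D := C * Real.exp 2 * (N * (t / N * Real.exp (-(t / N))))) hab fun s hs => ?_).trans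
        (mul_le_of_le_one_right (by positivity) hab1)
    refine (mul_le_of_le_one_left (norm_nonneg _) (abs_bandCutoff_le r R s)).trans ?_
    rw [norm_smul, norm_pow, norm_I_div ht0]
    refine le_trans ?_ (inv_pow_mul_factorial_mul_pow_le hC.le hN0 hmt)
    gcongr
    refine (hGb s hs k).trans ?_
    gcongr
    exact mul_le_of_le_one_right hC.le (hI s hs).2
  have key := integral_smul_exp_smul_eq (G := fun j => iteratedDeriv j F) hab ht0.ne' hG
    (hasDerivAt_bandCutoff r R) (continuous_iteratedDeriv_bandCutoff r R 1) k
  simp only [iteratedDeriv_zero] at key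
  rw [key]
  have hpos : 0 ≤ N * (t / N * Real.exp (-(t / N))) := by positivity
  have hpos2 : 0 < 1 / t := by positivity
  refine (norm_sub_le _ _).trans ((add_le_add (norm_add_le _ _) (norm_sub_le _ _)).trans ?_)
  rw [norm_smul_exp_smul, norm_smul_exp_smul]
  refine (add_le_add (add_le_add hmid hrem) (add_le_add (hbdry b hb) (hbdry a ha))).trans ?_
  have e1 : 0 ≤ 9 * C * J := by positivity
  have e2 : 0 ≤ 18 * C * m 1 := by positivity
  have e3 : 0 ≤ C * Real.exp 2 := by positivity
  nlinarith [mul_nonneg e1 hpos, mul_nonneg e1 hpos2.le, mul_nonneg e2 hpos, mul_nonneg e2 hr.le,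
    mul_nonneg e3 hr.le, mul_nonneg e3 hpos2.le]

/-- The oscillatory integral over high frequencies, in the analytic case. -/
theorem exists_norm_integral_high_le [CompleteSpace X] {F : ℝ → X} (hF : ContDiffOn ℝ ∞ F {0}ᶜ)
    {M : ℝ → ℝ} (hM : MonotoneOn M (Ici 1)) (hM1 : ∀ R ∈ Ici (1 : ℝ), 1 ≤ M R) {C : ℝ}
    (hC : 0 < C) (hhigh : ∀ s : ℝ, 1 ≤ |s| → ∀ j : ℕ,
      ‖iteratedDeriv j F s‖ ≤ C * (j.factorial : ℝ) * M |s| ^ (j + 1)) :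
    ∃ D : ℝ, 0 < D ∧ ∀ r R t a b : ℝ, 0 < r → r ≤ 1 / 4 → 4 ≤ R → M R ≤ t → a ≤ b → b - a ≤ R →
      (∀ s ∈ Icc a b, 1 ≤ |s| ∧ |s| ≤ R) → (|a| = 1 ∨ |a| = R) → (|b| = 1 ∨ |b| = R) →
      ‖∫ s in a..b, bandCutoff r R s • (Complex.exp (Complex.I * s * t) • F s)‖ ≤
        D * (1 / R + 1 / t + R * M R * (t / M R * Real.exp (-(t / M R)))) := by
  obtain ⟨B₁, hB₁, hc₁⟩ := exists_abs_pow_mul_iteratedDeriv_cutoff_le 0 1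
  obtain ⟨B₂, hB₂, hc₂⟩ := exists_abs_pow_mul_iteratedDeriv_cutoff_le 0 2
  simp only [pow_zero, one_mul] at hc₁ hc₂
  have hM11 : 1 ≤ M 1 := hM1 1 self_mem_Ici
  -- B₂ comes from the integral with the second derivative of the cutoff, 36 C B₁ from the endpoints
  -- in the second round, 18 C M(1) from those in the first, and the exponential from both
  -- remainders.
  refine ⟨36 * C * (B₁ + B₂) + 18 * C * M 1 + C * Real.exp 2 * (1 + B₁), by positivity,
    fun r R t a b hr hr4 hR hMt hab habR hI ha hb => ?_⟩
  have hR0 : 0 < R := by linarith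
  have hR1 : R ∈ Ici (1 : ℝ) := mem_Ici.2 (by linarith)
  have hMR : 1 ≤ M R := hM1 R hR1
  set N := M R with hN
  have hN0 : 0 < N := by linarith
  have ht0 : 0 < t := by linarith
  have ht1 : 1 ≤ t := by linarith
  set k := ⌊t / N⌋₊ with hk
  have hkN : (k : ℝ) * N ≤ t := floor_div_mul_le hN0 ht0.le
  have hkt : (k : ℝ) ≤ t := (le_mul_of_one_le_right (by positivity) hMR).trans hkN
  have hamem : a ∈ Icc a b := left_mem_Icc.2 hab
  have hbmem : b ∈ Icc a b := right_mem_Icc.2 hab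
  have hG : ∀ s ∈ Icc a b, ∀ j, HasDerivAt (iteratedDeriv j F) (iteratedDeriv (j + 1) F s) s :=
    fun s hs j => hasDerivAt_iteratedDeriv_of_contDiffOn hF
      (abs_pos.1 (one_pos.trans_le (hI s hs).1)) j
  have hGb : ∀ s ∈ Icc a b, ∀ j, ‖iteratedDeriv j F s‖ ≤ C * (j.factorial * N ^ (j + 1)) := by
    intro s hs j
    obtain ⟨h1, h2⟩ := hI s hs
    have h3 : M |s| ≤ N := hM h1 hR1 h2
    have h4 : 1 ≤ M |s| := hM1 _ h1
    calc _ ≤ C * (j.factorial : ℝ) * M |s| ^ (j + 1) := hhigh s h1 j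
      _ ≤ C * (j.factorial : ℝ) * N ^ (j + 1) := by gcongr
      _ = _ := by ring
  have hχ₁ : ∀ s ∈ Icc a b, |iteratedDeriv 1 (bandCutoff r R) s| ≤ 2 / R * B₁ := by
    intro s hs
    rw [iteratedDeriv_bandCutoff_of_high one_ne_zero hr hr4 (hI s hs).1, abs_mul, pow_one,
      abs_of_pos (by positivity)]
    gcongr
    exact hc₁ _
  have hχ₂ : ∀ s ∈ Icc a b, |iteratedDeriv 2 (bandCutoff r R) s| ≤ (2 / R) ^ 2 * B₂ := by
    intro s hs
    rw [iteratedDeriv_bandCutoff_of_high two_ne_zero hr hr4 (hI s hs).1, abs_mul,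
      abs_of_pos (by positivity : 0 < (2 / R) ^ 2)]
    gcongr
    exact hc₂ _
  have hQ : ∀ s ∈ Icc a b,
      ‖ibpSumTwo (fun j => iteratedDeriv j F) (Complex.I / t) k s‖ ≤ 9 * C := by
    intro s hs
    refine (norm_ibpSumTwo_le ht0 hC.le hN0.le hkN (hGb s hs)).trans ?_
    refine (div_le_self (by positivity) ht1).trans ?_
    exact mul_le_of_le_one_right (by positivity) ((div_le_one ht0).2 hMt)
  have hbdry : ∀ s, (|s| = 1 ∨ |s| = R) → |bandCutoff r R s| *
      ‖ibpSum (fun j => iteratedDeriv j F) (Complex.I / t) k s‖ ≤ 9 * C * M 1 * (1 / t) := by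
    rintro s (hs | hs)
    · have h1 : ‖ibpSum (fun j => iteratedDeriv j F) (Complex.I / t) k s‖ ≤ 9 * C * (M 1 / t) := by
        refine norm_ibpSum_le ht0 hC.le (by linarith) ?_ fun j => ?_
        · have : M 1 ≤ N := hM self_mem_Ici hR1 hR1
          exact (mul_le_mul_of_nonneg_left this (by positivity)).trans hkN
        · have := hhigh s hs.ge j
          rw [hs, mul_assoc] at this
          exact this
      calc _ ≤ 1 * (9 * C * (M 1 / t)) := mul_le_mul (abs_bandCutoff_le r R s) h1
            (norm_nonneg _) zero_le_one
        _ = _ := by ring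
    · rw [bandCutoff_eq_zero_of_ge hr hR0 (by linarith) hs.ge, abs_zero, zero_mul]
      positivity
  have hbdry₂ : ∀ s ∈ Icc a b, |iteratedDeriv 1 (bandCutoff r R) s| *
      ‖ibpSumTwo (fun j => iteratedDeriv j F) (Complex.I / t) k s‖ ≤ 18 * C * B₁ * (1 / R) := by
    intro s hs
    calc _ ≤ (2 / R * B₁) * (9 * C) :=
          mul_le_mul (hχ₁ s hs) (hQ s hs) (norm_nonneg _) (by positivity)
      _ = _ := by ring
  -- The second derivative of the cutoff is O(1/R²) on an interval of length at most R, whence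
  -- O(1/R).
  have hmid : ‖∫ s in a..b, iteratedDeriv 2 (bandCutoff r R) s • (Complex.exp (Complex.I * s * t) •
      ibpSumTwo (fun j => iteratedDeriv j F) (Complex.I / t) k s)‖ ≤ 36 * C * B₂ * (1 / R) := by
    refine (norm_integral_smul_exp_smul_le (D := (2 / R) ^ 2 * B₂ * (9 * C)) hab fun s hs =>
      mul_le_mul (hχ₂ s hs) (hQ s hs) (norm_nonneg _) (by positivity)).trans ?_
    calc _ ≤ (2 / R) ^ 2 * B₂ * (9 * C) * R := by gcongr
      _ = _ := by field_simp; ring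
  have hfac := inv_pow_mul_factorial_mul_pow_le hC.le hN0 hMt
  set U := t / N * Real.exp (-(t / N)) with hU
  have hU0 : 0 ≤ U := by positivity
  have hGk : ∀ s ∈ Icc a b, (1 / t) ^ k * ‖iteratedDeriv k F s‖ ≤ C * Real.exp 2 * (N * U) := by
    intro s hs
    refine le_trans ?_ hfac
    gcongr
    exact hGb s hs k
  have hrem : ‖∫ s in a..b, bandCutoff r R s • (Complex.exp (Complex.I * s * t) •
      ((Complex.I / t) ^ k • iteratedDeriv k F s))‖ ≤ C * Real.exp 2 * (R * N * U) := by
    refine (norm_integral_smul_exp_smul_le (D := C * Real.exp 2 * (N * U)) hab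
      fun s hs => ?_).trans ?_
    · refine (mul_le_of_le_one_left (norm_nonneg _) (abs_bandCutoff_le r R s)).trans ?_
      rw [norm_smul, norm_pow, norm_I_div ht0]
      exact hGk s hs
    · calc _ ≤ C * Real.exp 2 * (N * U) * R := by gcongr
        _ = _ := by ring
  -- The extra factor k/t of the second round is at most 1, because kN ≤ t and N ≥ 1.
  have hrem₂ : ‖∫ s in a..b, iteratedDeriv 1 (bandCutoff r R) s •
      (Complex.exp (Complex.I * s * t) •
        (((k : ℂ) * (Complex.I / t) ^ (k + 1)) • iteratedDeriv k F s))‖ ≤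
      C * Real.exp 2 * B₁ * (R * N * U) := by
    refine (norm_integral_smul_exp_smul_le (D := B₁ * (C * Real.exp 2 * (N * U))) hab
      fun s hs => ?_).trans ?_
    · have h1 : |iteratedDeriv 1 (bandCutoff r R) s| ≤ B₁ := by
        refine (hχ₁ s hs).trans (mul_le_of_le_one_left hB₁.le ?_)
        rw [div_le_one hR0]
        linarith
      refine mul_le_mul h1 ?_ (norm_nonneg _) hB₁.le
      rw [norm_smul, norm_mul, norm_pow, norm_I_div ht0, Complex.norm_natCast]
      calc (k : ℝ) * (1 / t) ^ (k + 1) * ‖iteratedDeriv k F s‖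
          = (k / t) * ((1 / t) ^ k * ‖iteratedDeriv k F s‖) := by ring
        _ ≤ 1 * ((1 / t) ^ k * ‖iteratedDeriv k F s‖) := by
            gcongr
            exact (div_le_one ht0).2 hkt
        _ ≤ _ := by rw [one_mul]; exact hGk s hs
    · calc _ ≤ B₁ * (C * Real.exp 2 * (N * U)) * R := by gcongr
        _ = _ := by ring
  have key := integral_smul_exp_smul_eq (G := fun j => iteratedDeriv j F) hab ht0.ne' hG
    (hasDerivAt_bandCutoff r R) (continuous_iteratedDeriv_bandCutoff r R 1) k
  have key₂ := integral_smul_exp_smul_ibpSum_eq (G := fun j => iteratedDeriv j F) hab ht0.ne' hG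
    (hasDerivAt_iteratedDeriv_bandCutoff r R 1) (continuous_iteratedDeriv_bandCutoff r R 2) k
  simp only [iteratedDeriv_zero] at key
  rw [key, key₂]
  refine (norm_sub_le _ _).trans ((add_le_add ((norm_add_le _ _).trans (add_le_add
    ((norm_sub_le _ _).trans (add_le_add (norm_add_le _ _) (norm_sub_le _ _))) le_rfl))
    (norm_sub_le _ _)).trans ?_)
  rw [norm_smul_exp_smul, norm_smul_exp_smul, norm_smul_exp_smul, norm_smul_exp_smul]
  refine (add_le_add (add_le_add (add_le_add (add_le_add hmid hrem₂)
    (add_le_add (hbdry₂ b hbmem) (hbdry₂ a hamem))) hrem)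
    (add_le_add (hbdry b hb) (hbdry a ha))).trans ?_
  have hV : 0 ≤ R * N * U := by positivity
  have hR' : 0 ≤ 1 / R := by positivity
  have ht' : 0 ≤ 1 / t := by positivity
  have e1 : 0 ≤ 36 * C * (B₁ + B₂) := by positivity
  have e2 : 0 ≤ 18 * C * M 1 := by positivity
  have e3 : 0 ≤ C * Real.exp 2 * (1 + B₁) := by positivity
  linarith [mul_nonneg e1 hV, mul_nonneg e1 ht', mul_nonneg e2 hV, mul_nonneg e2 hR',
    mul_nonneg e3 hR', mul_nonneg e3 ht']

/-- The cut at ±1 separates the two regimes, so that a different k can be used in each; the piece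
over [-r, r] vanishes with the cutoff. -/
theorem integral_bandCutoff_eq_add {F : ℝ → X} (hF : ContDiffOn ℝ ∞ F {0}ᶜ) {r R : ℝ} (hr : 0 < r)
    (hr1 : r ≤ 1) (hR : 2 ≤ R) (t : ℝ) :
    ∫ s : ℝ, (Complex.exp (Complex.I * s * t) * (bandCutoff r R s : ℝ)) • F s =
      (∫ s in (-R)..(-1), bandCutoff r R s • (Complex.exp (Complex.I * s * t) • F s)) +
      (∫ s in (-1)..(-r), bandCutoff r R s • (Complex.exp (Complex.I * s * t) • F s)) +
      (∫ s in r..1, bandCutoff r R s • (Complex.exp (Complex.I * s * t) • F s)) +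
      ∫ s in (1)..R, bandCutoff r R s • (Complex.exp (Complex.I * s * t) • F s) := by
  have hR0 : 0 < R := by linarith
  set g : ℝ → X := fun s => bandCutoff r R s • (Complex.exp (Complex.I * s * t) • F s) with hg
  have hgc : Continuous g := by
    have h1 : Continuous fun s => bandCutoff r R s • F s :=
      (contDiff_bandCutoff_smul (n := ⊤) hF hr hR0).continuous
    have h2 : g = fun s : ℝ => Complex.exp (Complex.I * s * t) • (bandCutoff r R s • F s) := by
      funext s
      rw [hg]
      exact smul_comm _ _ _
    rw [h2]
    exact Continuous.smul (by fun_prop) h1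
  have hi : ∀ a b, IntervalIntegrable g volume a b := fun a b => hgc.intervalIntegrable a b
  have hsupp : Function.support g ⊆ Ioc (-R) R := by
    intro s hs
    have : |s| < R := by
      by_contra! h
      exact hs (by rw [hg]; simp only; rw [bandCutoff_eq_zero_of_ge hr hR0 (by linarith) h, zero_smul])
    exact ⟨(abs_lt.1 this).1, (abs_lt.1 this).2.le⟩
  have hzero : ∫ s in (-r)..r, g s = 0 := by
    rw [intervalIntegral.integral_congr (g := fun _ => (0 : X)), intervalIntegral.integral_zero]
    intro s hs
    rw [uIcc_of_le (by linarith)] at hs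
    have : |s| ≤ r := abs_le.2 hs
    simp only [hg]
    rw [bandCutoff_eq_zero_of_le hr hR0 this (by linarith), zero_smul]
  have heq : ∫ s : ℝ, (Complex.exp (Complex.I * s * t) * (bandCutoff r R s : ℝ)) • F s =
      ∫ s, g s := by
    congr 1 with s
    rw [mul_comm, mul_smul, Complex.coe_smul]
  rw [heq, ← intervalIntegral.integral_eq_integral_of_support_subset hsupp,
    ← intervalIntegral.integral_add_adjacent_intervals (hi (-R) 1) (hi 1 R),
    ← intervalIntegral.integral_add_adjacent_intervals (hi (-R) r) (hi r 1),
    ← intervalIntegral.integral_add_adjacent_intervals (hi (-R) (-r)) (hi (-r) r), hzero, add_zero,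
    ← intervalIntegral.integral_add_adjacent_intervals (hi (-R) (-1)) (hi (-1) (-r))]

/-- The estimate of the oscillatory integral in the analytic case, obtained by integrating by parts
as often as is optimal at low and at high frequencies. -/
theorem exists_norm_integral_bandCutoff_le_of_analytic [CompleteSpace X] {F : ℝ → X}
    (hF : ContDiffOn ℝ ∞ F {0}ᶜ) {m M : ℝ → ℝ} (hm : AntitoneOn m (Ioc 0 1))
    (hm1 : ∀ r ∈ Ioc (0 : ℝ) 1, 1 ≤ m r) (hM : MonotoneOn M (Ici 1))
    (hM1 : ∀ R ∈ Ici (1 : ℝ), 1 ≤ M R) {C : ℝ} (hC : 0 < C)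
    (hlow : ∀ s : ℝ, 0 < |s| → |s| ≤ 1 → ∀ j : ℕ,
      ‖iteratedDeriv j F s‖ ≤ C * (j.factorial : ℝ) * |s| * m |s| ^ (j + 1))
    (hhigh : ∀ s : ℝ, 1 ≤ |s| → ∀ j : ℕ,
      ‖iteratedDeriv j F s‖ ≤ C * (j.factorial : ℝ) * M |s| ^ (j + 1)) :
    ∃ D : ℝ, 0 < D ∧ ∀ r R t : ℝ, 0 < r → r ≤ 1 / 4 → 4 ≤ R → m r ≤ t → M R ≤ t →
      ‖∫ s : ℝ, (Complex.exp (Complex.I * s * t) * (bandCutoff r R s : ℝ)) • F s‖ ≤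
        D * (r + 1 / R + 1 / t + m r * (t / m r * Real.exp (-(t / m r))) +
          R * M R * (t / M R * Real.exp (-(t / M R)))) := by
  obtain ⟨D₁, hD₁, h₁⟩ := exists_norm_integral_low_le hF hm hm1 hC hlow
  obtain ⟨D₂, hD₂, h₂⟩ := exists_norm_integral_high_le hF hM hM1 hC hhigh
  refine ⟨2 * D₁ + 2 * D₂, by positivity, fun r R t hr hr4 hR hmt hMt => ?_⟩
  have hmr : 1 ≤ m r := hm1 r ⟨hr, by linarith⟩
  have hMR : 1 ≤ M R := hM1 R (mem_Ici.2 (by linarith))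
  have ht0 : 0 < t := by linarith
  have hR0 : 0 < R := by linarith
  have b1 := h₂ r R t (-R) (-1) hr hr4 hR hMt (by linarith) (by linarith)
    (fun s hs => by
      rw [abs_of_neg (by linarith [hs.2])]
      exact ⟨by linarith [hs.2], by linarith [hs.1]⟩)
    (Or.inr (by rw [abs_neg, abs_of_pos hR0])) (Or.inl (by simp))
  have b2 := h₁ r R t (-1) (-r) hr hr4 hR hmt (by linarith) (by linarith)
    (fun s hs => by
      rw [abs_of_neg (by linarith [hs.2])]
      exact ⟨by linarith [hs.2], by linarith [hs.1]⟩)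
    (Or.inr (by simp)) (Or.inl (by rw [abs_neg, abs_of_pos hr]))
  have b3 := h₁ r R t r 1 hr hr4 hR hmt (by linarith) (by linarith)
    (fun s hs => by
      rw [abs_of_pos (by linarith [hs.1])]
      exact hs)
    (Or.inl (abs_of_pos hr)) (Or.inr (by simp))
  have b4 := h₂ r R t 1 R hr hr4 hR hMt (by linarith) (by linarith)
    (fun s hs => by
      rw [abs_of_pos (by linarith [hs.1])]
      exact hs)
    (Or.inl (by simp)) (Or.inr (abs_of_pos hR0))
  rw [integral_bandCutoff_eq_add hF hr (by linarith) (by linarith)]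
  refine (norm_add_le _ _).trans ((add_le_add (norm_add₃_le) le_rfl).trans ?_)
  refine (add_le_add (add_le_add (add_le_add b1 b2) b3) b4).trans ?_
  have e1 : 0 ≤ m r * (t / m r * Real.exp (-(t / m r))) := by positivity
  have e2 : 0 ≤ R * M R * (t / M R * Real.exp (-(t / M R))) := by positivity
  have e3 : 0 < 1 / R := by positivity
  linarith [mul_nonneg hD₁.le e2, mul_nonneg hD₂.le e1, mul_nonneg hD₁.le e3.le,
    mul_nonneg hD₂.le hr.le]

/-! ### The choice of r and R in case (b) -/

/-- With T = t/N the equation says 1 + N/r = e^{cT}. So N ≤ r e^{cT}, and r T e^{-(1-c)T} ≤ r/(1-c).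
The bound r ≤ 1/4 gives 1 + N/r > e, hence cT ≥ 1 and T ≥ 1. -/
theorem low_remainder_le {c r N t : ℝ} (hc : 0 < c) (hc1 : c < 1) (hr : 0 < r) (hr4 : r ≤ 1 / 4)
    (hN : 1 ≤ N) (h : N * Real.log (1 + N / r) = c * t) :
    N ≤ t ∧ N * (t / N * Real.exp (-(t / N))) ≤ 1 / (1 - c) * r := by
  set T := t / N with hT
  have hN0 : 0 < N := by linarith
  have hlog : Real.log (1 + N / r) = c * T := by
    rw [hT, ← mul_div_assoc, eq_div_iff hN0.ne', mul_comm]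
    exact h
  have hpos : 0 < 1 + N / r := by positivity
  have hexp : 1 + N / r = Real.exp (c * T) := by rw [← hlog, Real.exp_log hpos]
  have h3 : 3 ≤ 1 + N / r := by
    have : 4 ≤ N / r := by rw [le_div_iff₀ hr]; linarith
    linarith
  have hcT : 1 ≤ c * T := by
    rw [← hlog, Real.le_log_iff_exp_le hpos]
    linarith [Real.exp_one_lt_d9]
  have hT1 : 1 ≤ T := by nlinarith
  refine ⟨(one_le_div hN0).1 hT1, ?_⟩
  have hNr : N ≤ r * Real.exp (c * T) := by
    have : N / r ≤ Real.exp (c * T) := by linarith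
    rw [div_le_iff₀ hr] at this
    linarith
  have hδ := mul_exp_neg_mul_le (sub_pos.2 hc1) T
  calc N * (T * Real.exp (-T)) ≤ r * Real.exp (c * T) * (T * Real.exp (-T)) := by gcongr
    _ = r * (T * Real.exp (-((1 - c) * T))) := by
        rw [show -((1 - c) * T) = c * T + -T by ring, Real.exp_add]
        ring
    _ ≤ r * (1 / (1 - c)) := by gcongr
    _ = _ := mul_comm _ _

/-- Here (1+R)N = e^{cT}. One factor e^{cT} absorbs RN, and a second is spent on e^{-cT} ≤ 1/R; what
is left is T e^{-(1-2c)T}, bounded exactly because c < 1/2. -/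
theorem high_remainder_le {c R N t : ℝ} (hc : 0 < c) (hc2 : c < 1 / 2) (hR : 4 ≤ R)
    (hN : 1 ≤ N) (h : N * (Real.log (1 + R) + Real.log N) = c * t) :
    N ≤ t ∧ R * N * (t / N * Real.exp (-(t / N))) ≤ 1 / (1 - 2 * c) * (1 / R) := by
  set T := t / N with hT
  have hN0 : 0 < N := by linarith
  have hR0 : 0 < R := by linarith
  have hlog : Real.log ((1 + R) * N) = c * T := by
    rw [Real.log_mul (by positivity) (by positivity), hT, ← mul_div_assoc, eq_div_iff hN0.ne',
      mul_comm]
    exact h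
  have hexp : (1 + R) * N = Real.exp (c * T) := by rw [← hlog, Real.exp_log (by positivity)]
  have hcT : 1 ≤ c * T := by
    rw [← hlog, Real.le_log_iff_exp_le (by positivity)]
    nlinarith [Real.exp_one_lt_d9]
  have hT1 : 1 ≤ T := by nlinarith
  refine ⟨(one_le_div hN0).1 hT1, ?_⟩
  have h1 : R * N ≤ Real.exp (c * T) := by rw [← hexp]; nlinarith
  have h2 : Real.exp (-(c * T)) ≤ 1 / R := by
    rw [Real.exp_neg, ← one_div]
    refine one_div_le_one_div_of_le hR0 ?_
    rw [← hexp]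
    nlinarith
  have hδ := mul_exp_neg_mul_le (by linarith : 0 < 1 - 2 * c) T
  have hδ0 : 0 < 1 / (1 - 2 * c) := one_div_pos.2 (by linarith)
  calc R * N * (T * Real.exp (-T)) ≤ Real.exp (c * T) * (T * Real.exp (-T)) := by gcongr
    _ = (T * Real.exp (-((1 - 2 * c) * T))) * Real.exp (-(c * T)) := by
        rw [show -((1 - 2 * c) * T) = c * T + (-T) + c * T by ring, Real.exp_add, Real.exp_add,
          Real.exp_neg (c * T)]
        field_simp
    _ ≤ 1 / (1 - 2 * c) * (1 / R) := by gcongr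

/-- Logarithmically corrected decay rates for a function which is small up to oscillatory
integrals. -/
theorem isBigO_of_analytic [CompleteSpace X] {f F : ℝ → X} {A : ℝ}
    (hA : ∀ r > 0, ∀ R > 0, ∀ t ≥ 1, ‖f t‖ ≤ A * (r + 1 / R) +
      ‖∫ s : ℝ, (Complex.exp (Complex.I * s * t) * (bandCutoff r R s : ℝ)) • F s‖) (hA0 : 0 < A)
    {m M : ℝ → ℝ} (hmc : ContinuousOn m (Ioc 0 1)) (hm : AntitoneOn m (Ioc 0 1))
    (hm1 : ∀ r ∈ Ioc (0 : ℝ) 1, 1 ≤ m r) (hMc : ContinuousOn M (Ici 1))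
    (hM : MonotoneOn M (Ici 1)) (hM1 : ∀ R ∈ Ici (1 : ℝ), 1 ≤ M R)
    (hF : ContDiffOn ℝ ∞ F {0}ᶜ) {C : ℝ} (hC : 0 < C)
    (hlow : ∀ s : ℝ, 0 < |s| → |s| ≤ 1 → ∀ j : ℕ,
      ‖iteratedDeriv j F s‖ ≤ C * (j.factorial : ℝ) * |s| * m |s| ^ (j + 1))
    (hhigh : ∀ s : ℝ, 1 ≤ |s| → ∀ j : ℕ,
      ‖iteratedDeriv j F s‖ ≤ C * (j.factorial : ℝ) * M |s| ^ (j + 1))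
    {c : ℝ} (hc : 0 < c) (hc2 : c < 1 / 2) :
    (fun t : ℝ => ‖f t‖) =O[atTop] fun t : ℝ =>
      lowerInv (lowerLog m) (c * t) + 1 / upperInv (upperLog M) (c * t) + 1 / t := by
  obtain ⟨D, hD0, hD⟩ := exists_norm_integral_bandCutoff_le_of_analytic hF hm hm1 hM hM1 hC
    hlow hhigh
  have hδ₁ : 0 < 1 / (1 - c) := one_div_pos.2 (by linarith)
  have hδ₂ : 0 < 1 / (1 - 2 * c) := one_div_pos.2 (by linarith)
  refine IsBigO.of_bound (A + D * (1 + 1 / (1 - c) + 1 / (1 - 2 * c))) ?_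
  filter_upwards [eventually_ge_atTop 1,
    eventually_lowerInv (continuousOn_lowerLog hmc hm1) (lowerLog_strictAntiOn hm hm1)
      (exists_le_lowerLog hm1) hc (by norm_num : (0 : ℝ) < 1 / 4),
    eventually_upperInv (continuousOn_upperLog hMc hM1) (upperLog_strictMonoOn hM hM1)
      (exists_le_upperLog hM1) hc 4] with t ht hr hR
  obtain ⟨⟨hr0, hr1⟩, hr4, hrt⟩ := hr
  obtain ⟨hR1, hR4, hRt⟩ := hR
  set r := lowerInv (lowerLog m) (c * t)
  set R := upperInv (upperLog M) (c * t)
  have hR0 : 0 < R := by linarith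
  obtain ⟨h1, h2⟩ := low_remainder_le hc (by linarith) hr0 hr4 (hm1 r ⟨hr0, hr1⟩) hrt
  obtain ⟨h3, h4⟩ := high_remainder_le hc hc2 hR4 (hM1 R hR1) hRt
  have h5 := hD r R t hr0 hr4 hR4 h1 h3
  have hpos1 : 0 < 1 / R := by positivity
  have hpos2 : 0 < 1 / t := by positivity
  rw [norm_norm, Real.norm_of_nonneg (by positivity), add_mul]
  refine (hA r hr0 R hR0 t ht).trans (add_le_add ?_ (h5.trans ?_))
  · exact mul_le_mul_of_nonneg_left (by linarith) hA0.le
  · rw [mul_assoc D]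
    refine mul_le_mul_of_nonneg_left ?_ hD0.le
    nlinarith [mul_pos hδ₁ hpos1, mul_pos hδ₁ hpos2, mul_pos hδ₂ hr0, mul_pos hδ₂ hpos2]

end

end QIngham

/-! ### The theorem, by extension from the half-line -/

theorem theorem2p13 {X : Type*} [NormedAddCommGroup X] [NormedSpace ℂ X] [CompleteSpace X]
    (f : ℝ → X)
    (hf_cont : ContinuousOn f (Ici 0))
    (hf_bdd : ∃ K : ℝ, ∀ t : ℝ, 0 ≤ t → ‖f t‖ ≤ K)
    (hf_lip : ∃ L : ℝ≥0, LipschitzOnWith L f (Ici 0))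
    (hf_prim : ∃ K : ℝ, ∀ t : ℝ, 0 ≤ t → ‖∫ s in (0 : ℝ)..t, f s‖ ≤ K)
    (F : ℝ → X) (hF : QIngham.IsBoundaryFunction f {0} F) :
    Tendsto f atTop (𝓝 0) ∧
    ∀ m M : ℝ → ℝ,
      ContinuousOn m (Ioc 0 1) → AntitoneOn m (Ioc 0 1) → (∀ r ∈ Ioc (0 : ℝ) 1, 1 ≤ m r) →
      ContinuousOn M (Ici 1) → MonotoneOn M (Ici 1) → (∀ R ∈ Ici (1 : ℝ), 1 ≤ M R) →
      (∀ k : ℕ, 1 ≤ k → ContDiffOn ℝ (k : WithTop ℕ∞) F {0}ᶜ →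
        (∃ C : ℝ, 0 < C ∧
          (∀ s : ℝ, 0 < |s| → |s| ≤ 1 → ∀ j : ℕ, j ≤ k →
            ‖iteratedDeriv j F s‖ ≤ C * |s| ^ (k - j) * m |s| ^ (k + 1)) ∧
          (∀ s : ℝ, 1 ≤ |s| → ∀ j : ℕ, j ≤ k →
            ‖iteratedDeriv j F s‖ ≤ C * M |s| ^ (j + 1))) →
        ∀ c : ℝ, 0 < c →
          (fun t : ℝ => ‖f t‖) =O[atTop] fun t : ℝ =>
            QIngham.lowerInv (QIngham.lowerK m k) (c * t) +
              1 / QIngham.upperInv (QIngham.upperK M k) (c * t)) ∧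
      (ContDiffOn ℝ ∞ F {0}ᶜ →
        (∃ C : ℝ, 0 < C ∧
          (∀ s : ℝ, 0 < |s| → |s| ≤ 1 → ∀ j : ℕ,
            ‖iteratedDeriv j F s‖ ≤ C * (j.factorial : ℝ) * |s| * m |s| ^ (j + 1)) ∧
          (∀ s : ℝ, 1 ≤ |s| → ∀ j : ℕ,
            ‖iteratedDeriv j F s‖ ≤ C * (j.factorial : ℝ) * M |s| ^ (j + 1))) →
        ∀ c : ℝ, 0 < c → c < 1 / 2 →
          (fun t : ℝ => ‖f t‖) =O[atTop] fun t : ℝ =>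
            QIngham.lowerInv (QIngham.lowerLog m) (c * t) +
              1 / QIngham.upperInv (QIngham.upperLog M) (c * t) + 1 / t) := by
  obtain ⟨K, hK⟩ := hf_bdd
  obtain ⟨L, hL⟩ := hf_lip
  obtain ⟨K', hK'⟩ := hf_prim
  -- Extending by the constant f(0) keeps the bounds on the whole line; the Laplace transform, the
  -- primitive and the behaviour at infinity see only t ≥ 0.
  set g : ℝ → X := fun t => f (max t 0) with hg
  have hgf : ∀ t, 0 ≤ t → g t = f t := fun t ht => by simp [hg, max_eq_left ht]
  have hgc : Continuous g :=
    hf_cont.comp_continuous (continuous_id.max continuous_const) fun t =>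
      mem_Ici.2 (le_max_right t 0)
  have hgb : ∀ t, ‖g t‖ ≤ K := fun t => hK _ (le_max_right _ _)
  have hgl : LipschitzWith L g := by
    refine LipschitzWith.of_dist_le_mul fun x y => ?_
    refine (hL.dist_le_mul _ (le_max_right x 0) _ (le_max_right y 0)).trans ?_
    gcongr
    rw [Real.dist_eq, Real.dist_eq]
    exact abs_max_sub_max_le_abs x y 0
  have hgp : ∀ t : ℝ, 0 ≤ t → ‖∫ s in (0 : ℝ)..t, g s‖ ≤ K' := by
    intro t ht
    rw [intervalIntegral.integral_congr (g := f)]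
    · exact hK' t ht
    · intro s hs
      rw [uIcc_of_le ht] at hs
      exact hgf s hs.1
  have hgF : QIngham.IsBoundaryFunction g {0} F := by
    have hlap : QIngham.laplace g = QIngham.laplace f := by
      funext z
      refine setIntegral_congr_fun measurableSet_Ioi fun t ht => ?_
      simp only [hgf t (le_of_lt ht)]
    refine ⟨hF.1, ?_⟩
    rw [hlap]
    exact hF.2
  have hev : g =ᶠ[atTop] f := by
    filter_upwards [eventually_ge_atTop 0] with t ht using hgf t ht
  obtain ⟨A, hA0, hA⟩ := QIngham.norm_le_add_norm_integral_bandCutoff hgc hgb hgl hgp hgF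
  refine ⟨(QIngham.tendsto_zero_of_isBoundaryFunction hgc hgb hgl hgp hgF).congr' hev, ?_⟩
  intro m M hmc hm hm1 hMc hM hM1
  refine ⟨fun k hk hFk ⟨C, hC, hlow, hhigh⟩ c hc => ?_,
    fun hFs ⟨C, hC, hlow, hhigh⟩ c hc hc2 => ?_⟩
  · exact (QIngham.isBigO_of_contDiffOn hA hmc hm hm1 hMc hM hM1 hk hFk hC hlow hhigh
      hc).congr' (hev.fun_comp norm) EventuallyEq.rfl
  · exact (QIngham.isBigO_of_analytic hA hA0 hmc hm hm1 hMc hM hM1 hFs hC hlow hhigh hc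
      hc2).congr' (hev.fun_comp norm) EventuallyEq.rfl
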